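/- **Setting.** Let $n,m\ge 0$ be integers. Let $\varphi(z,\chi)$ be holomorphic on an open neighborhood $D$ of the origin in $\mathbb C^n\times\mathbb C^n$ such that $\varphi(z,\bar z)$ is real whenever $(z,\bar z)\in D$, and such that $D_0:=\{\chi\in\mathbb C^n:(0,\bar\chi)\in D\}$ is connected. Let $M\subset\mathbb C^{n+1}$ pass through $0$ and be given, near $0$, by the rigid equation $\operatorname{Im} w=\varphi(z,\bar z)$, $(z,w)\in\mathbb C^n\times\mathbb C$. For a multiindex $\beta\in\mathbb N^n$ write $\varphi_{z^\beta}(0,\bar\chi)$ for the partial derivative of $\varphi$ with respect to the first group of variables, of multi-order $\beta$, evaluated at $(0,\bar\chi)$. A real hyperquadric in $\mathbb C^{n+m+1}$ is a real hypersurface given in some linear coordinates $(z',w')\in\mathbb C^{n+m}\times\mathbb C$ by $\operatorname{Im} w'=h(z',\bar z')$ with $h$ a (possibly degenerate) hermitian form. $M$ is transversally holomorphically embeddable into such a hyperquadric $M'$ if there is a holomorphic embedding $H$ of an open neighborhood of $M$ in $\mathbb C^{n+1}$ into $\mathbb C^{n+m+1}$ with $H(M)\subset M'$ and $H_*(T_x\mathbb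 C^{n+1})+T_{H(x)}M'=T_{H(x)}\mathbb C^{n+m+1}$ for all $x\in M$. Assign to $\varphi_{z^\beta}$ the weight $2|\beta|-1$, and let the weight $\operatorname{wt}P$ of a polynomial $P$ in variables indexed by multiindices $\beta\ne0$ be the maximal total weight of its monomials ($0$ for $P=0$). **Statement.** Suppose that $M$ is transversally holomorphically embeddable into a real hyperquadric in $\mathbb C^{n+m+1}$. Then for any $m+1$ multiindices $\alpha_1,\dots,\alpha_{m+1}\in\mathbb N^n$ with $|\alpha_j|\ge 2$ there exist an integer $k$ with $K:=\{j:|\alpha_j|=k\}\neq\emptyset$ and polynomials $P_j$ ($j\in K$) and $R$ with complex coefficients, in variables indexed by the multiindices $\beta$ with $0<|\beta|<k$, such that $$\sum_{j\in K}P_j\big(\varphi_{z^\beta}(0,\bar\chi)\big)\,\varphi_{z^{\alpha_j}}(0,\bar\chi)=R\big(\varphi_{z^\beta}(0,\bar\chi)\big)\qquad\text{for all }\chi\in D_0,$$ such that for at least one $j\in K$ the function $\chi\mapsto P_j(\varphi_{z^\beta}(0,\bar\chi))$ does not vanish identically on $D_0$, and such that $$\operatorname{wt}P_j\le(2k-2)(l-1)\quad(j\in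 K),\qquad \operatorname{wt}R\le(2k-2)\,l+1,$$ where $l\ge1$ is the number of all $j$ with $|\alpha_j|\le k$. -/

import Mathlib

open Topology

noncomputable section

namespace Rigid

/-- The order `|β| = β₁ + ⋯ + βₙ` of a multiindex. -/
def order {n : ℕ} (β : Fin n → ℕ) : ℕ := ∑ i, β i

/-- The partial derivative `∂f/∂z_i` of a function on `ℂⁿ`. -/
def pderiv {n : ℕ} (i : Fin n) (f : (Fin n → ℂ) → ℂ) : (Fin n → ℂ) → ℂ :=
  fun z => fderiv ℂ f z (Pi.single i 1)

/-- The mixed partial derivative `∂^{|β|} f / ∂z₁^{β₁} ⋯ ∂zₙ^{βₙ}`. -/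
def mixedDeriv {n : ℕ} (β : Fin n → ℕ) (f : (Fin n → ℂ) → ℂ) : (Fin n → ℂ) → ℂ :=
  (List.finRange n).foldr (fun i g => (pderiv i)^[β i] g) f

/-- `φ_{z^β}(0, χ̄)`, where `φ = φ(z, χ)` is holomorphic in both groups of variables and the
derivatives are taken in the first group. -/
def derivAtZero {n : ℕ} (φ : (Fin n → ℂ) × (Fin n → ℂ) → ℂ) (β : Fin n → ℕ)
    (χ : Fin n → ℂ) : ℂ :=
  mixedDeriv β (fun z => φ (z, star χ)) 0

/-- The multiindices `β` with `0 < |β| < k`. -/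
abbrev LowerIndex (n k : ℕ) : Type := {β : Fin n → ℕ // 0 < order β ∧ order β < k}

/-- Polynomials in formal variables `X_β`, `0 < |β| < k`, standing for `φ_{z^β}`. -/
abbrev JetPoly (n k : ℕ) : Type := MvPolynomial (LowerIndex n k) ℂ

/-- The weight `wt φ_{z^β} = 2|β| - 1` of a variable (here `|β| ≥ 1`). -/
def varWeight {n k : ℕ} (β : LowerIndex n k) : ℕ := 2 * order β.1 - 1

/-- The weight of a polynomial: the maximal total weight of its monomials. -/
def JetPoly.wt {n k : ℕ} (P : JetPoly n k) : ℕ := MvPolynomial.weightedTotalDegree varWeight P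

/-- The value `P(φ_{z^β}(0, χ̄))`. -/
def JetPoly.evalAt {n k : ℕ} (φ : (Fin n → ℂ) × (Fin n → ℂ) → ℂ) (P : JetPoly n k)
    (χ : Fin n → ℂ) : ℂ :=
  MvPolynomial.eval (fun β : LowerIndex n k => derivAtZero φ β.1 χ) P

/-- A real hyperquadric in `ℂ^{d+1} = ℂ^d × ℂ`: in some complex linear coordinates
`(z, w)` it is given by `Im w = h(z, z̄)` with `h` a hermitian form (possibly degenerate). -/
structure Hyperquadric (d : ℕ) where
  /-- the linear coordinates `(z, w)` -/
  coords : ((Fin d → ℂ) × ℂ) ≃L[ℂ] ((Fin d → ℂ) × ℂ)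
  /-- the matrix of the hermitian form -/
  form : Matrix (Fin d) (Fin d) ℂ
  isHermitian : form.IsHermitian

namespace Hyperquadric

variable {d : ℕ}

/-- The defining function `Im w - h(z, z̄)`; the value of the hermitian form is real. -/
def definingFunction (X : Hyperquadric d) (p : (Fin d → ℂ) × ℂ) : ℝ :=
  (X.coords p).2.im - (star (X.coords p).1 ⬝ᵥ (X.form.mulVec (X.coords p).1)).re

/-- The hyperquadric as a subset of `ℂ^{d+1}`. -/
def carrier (X : Hyperquadric d) : Set ((Fin d → ℂ) × ℂ) := {p | X.definingFunction p = 0}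

/-- The real tangent space `T_p X`, for a point `p` of the hyperquadric: the kernel of the
differential of the defining function. -/
def tangentSpace (X : Hyperquadric d) (p : (Fin d → ℂ) × ℂ) :
    Submodule ℝ ((Fin d → ℂ) × ℂ) :=
  (fderiv ℝ X.definingFunction p).ker

end Hyperquadric

/-- `M ⊆ ℂ^{n+1}` is transversally holomorphically embeddable into the hyperquadric `X`: there is
a holomorphic embedding `H` of an open neighborhood `Ω` of `M` into `ℂ^{d+1}` with `H(M) ⊆ X` and
`H_*(T_p ℂ^{n+1}) + T_{H(p)} X = T_{H(p)} ℂ^{d+1}` for all `p ∈ M`. -/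
def TransversallyEmbeddable {n d : ℕ} (M : Set ((Fin n → ℂ) × ℂ)) (X : Hyperquadric d) : Prop :=
  ∃ (Ω : Set ((Fin n → ℂ) × ℂ)) (H : (Fin n → ℂ) × ℂ → (Fin d → ℂ) × ℂ),
    IsOpen Ω ∧ M ⊆ Ω ∧
    AnalyticOnNhd ℂ H Ω ∧
    (∀ p ∈ Ω, Function.Injective (fderiv ℂ H p)) ∧
    IsEmbedding (Ω.domRestrict H) ∧
    Set.MapsTo H M X.carrier ∧
    ∀ p ∈ M, ((fderiv ℂ H p : (Fin n → ℂ) × ℂ →ₗ[ℂ] (Fin d → ℂ) × ℂ).range).restrictScalars ℝ ⊔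
      X.tangentSpace (H p) = ⊤

end Rigid

end

/-! Write ξ for the conjugate of χ and c = 2i. Polarizing H(M) ⊆ X makes z̄ an independent variable
ξ. Freezing the antiholomorphic argument then gives, for each small ξ, a linear form l_ξ on
ℂ^{n+m+1} that is constant in z along H(z, c(φ(z,ξ) − φ(0,ξ))) (`exists_linear_form`).
Transversality at 0 gives l_ξ(H_w(0)) ≠ 0 for small ξ.

Apply ∂_z^α at z = 0. By the chain rule, l_ξ kills c φ_{z^α}(0,ξ) H_w(0) + B_α(ξ), where the entries
of B_α are polynomials in the derivatives of order below |α|, of weight at most 2|α| − 2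
(`exists_mixedDeriv_comp_eq`). Up to the common factor −c l_ξ(H_w(0)), the form l_ξ therefore sends
B_α to φ_{z^α}, H_{z_i}(0) to φ_{z_i}, and H_w(0) to −1/c. Any linear relation among these vectors
turns into a relation among derivatives of φ, and the unknown form drops out.

The n+1 constant vectors H_w(0), H_{z_i}(0) are independent, and with the m+1 vectors B_{α_s} they
exceed the dimension n+m+1. Cramer's rule (`exists_weighted_relation`) gives a relation with
polynomial coefficients whose leading coefficient is not identically zero; counting the nonconstant
columns of the determinants gives the weights. Terms of order k go to the left side and the rest
into R, where the extra 1 is the weight of φ_{z_i}. The identity, known near ξ = 0, spreads over the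
connected domain by analytic continuation. -/

namespace Rigid

/-! ### Calculus of iterated partial derivatives of analytic germs. -/

section Calculus

variable {n : ℕ} {f g : (Fin n → ℂ) → ℂ} {x : Fin n → ℂ}

theorem pderiv_congr (i : Fin n) (h : f =ᶠ[𝓝 x] g) : pderiv i f =ᶠ[𝓝 x] pderiv i g := by
  filter_upwards [h.fderiv (𝕜 := ℂ)] with y hy
  simp only [pderiv, hy]

theorem analyticAt_pderiv (i : Fin n) (hf : AnalyticAt ℂ f x) : AnalyticAt ℂ (pderiv i f) x :=
  (ContinuousLinearMap.apply ℂ ℂ (Pi.single i (1 : ℂ) : Fin n → ℂ)).analyticAt _ |>.comp hf.fderiv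

theorem pderiv_comm (i j : Fin n) (hf : AnalyticAt ℂ f x) :
    pderiv i (pderiv j f) =ᶠ[𝓝 x] pderiv j (pderiv i f) := by
  filter_upwards [hf.eventually_analyticAt] with y hy
  have hd : DifferentiableAt ℂ (fderiv ℂ f) y := hy.fderiv.differentiableAt
  have hs : IsSymmSndFDerivAt ℂ f y := hy.contDiffAt.isSymmSndFDerivAt_of_omega
  have key : ∀ u v : Fin n → ℂ,
      fderiv ℂ (fun z => fderiv ℂ f z u) y v = fderiv ℂ (fderiv ℂ f) y v u := by
    intro u v
    rw [fderiv_clm_apply hd (differentiableAt_const u)]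
    simp
  change fderiv ℂ (fun z => fderiv ℂ f z _) y _ = fderiv ℂ (fun z => fderiv ℂ f z _) y _
  rw [key, key]
  exact hs _ _

theorem pderiv_add (i : Fin n) (hf : AnalyticAt ℂ f x) (hg : AnalyticAt ℂ g x) :
    pderiv i (fun z => f z + g z) =ᶠ[𝓝 x] fun z => pderiv i f z + pderiv i g z := by
  filter_upwards [hf.eventually_analyticAt, hg.eventually_analyticAt] with y hy hy'
  simp only [pderiv]
  rw [fderiv_fun_add hy.differentiableAt hy'.differentiableAt]
  rfl

theorem pderiv_mul (i : Fin n) (hf : AnalyticAt ℂ f x) (hg : AnalyticAt ℂ g x) :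
    pderiv i (fun z => f z * g z) =ᶠ[𝓝 x] fun z => pderiv i f z * g z + f z * pderiv i g z := by
  filter_upwards [hf.eventually_analyticAt, hg.eventually_analyticAt] with y hy hy'
  simp only [pderiv]
  rw [fderiv_fun_mul hy.differentiableAt hy'.differentiableAt]
  simp [mul_comm]
  ring

theorem pderiv_const (i : Fin n) (c : ℂ) : pderiv i (fun _ => c) = fun _ => 0 := by
  funext z
  simp [pderiv]

theorem iterate_pderiv_congr (i : Fin n) (k : ℕ) (h : f =ᶠ[𝓝 x] g) :
    (pderiv i)^[k] f =ᶠ[𝓝 x] (pderiv i)^[k] g := by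
  induction k with
  | zero => exact h
  | succ k ih =>
    rw [Function.iterate_succ_apply', Function.iterate_succ_apply']
    exact pderiv_congr i ih

theorem analyticAt_iterate_pderiv (i : Fin n) (k : ℕ) (hf : AnalyticAt ℂ f x) :
    AnalyticAt ℂ ((pderiv i)^[k] f) x := by
  induction k with
  | zero => exact hf
  | succ k ih =>
    rw [Function.iterate_succ_apply']
    exact analyticAt_pderiv i ih

theorem iterate_pderiv_comm (i j : Fin n) (k : ℕ) (hf : AnalyticAt ℂ f x) :
    (pderiv i)^[k] (pderiv j f) =ᶠ[𝓝 x] pderiv j ((pderiv i)^[k] f) := by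
  induction k with
  | zero => rfl
  | succ k ih =>
    rw [Function.iterate_succ_apply', Function.iterate_succ_apply']
    exact (pderiv_congr i ih).trans (pderiv_comm i j (analyticAt_iterate_pderiv i k hf))

/-- The mixed derivative that uses only the variables in a list. -/
noncomputable def listDeriv (l : List (Fin n)) (β : Fin n → ℕ) (f : (Fin n → ℂ) → ℂ) :
    (Fin n → ℂ) → ℂ :=
  l.foldr (fun i g => (pderiv i)^[β i] g) f

theorem listDeriv_cons (i : Fin n) (l : List (Fin n)) (β : Fin n → ℕ) (f : (Fin n → ℂ) → ℂ) :
    listDeriv (i :: l) β f = (pderiv i)^[β i] (listDeriv l β f) := rfl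

theorem analyticAt_listDeriv (l : List (Fin n)) (β : Fin n → ℕ) (hf : AnalyticAt ℂ f x) :
    AnalyticAt ℂ (listDeriv l β f) x := by
  induction l with
  | nil => exact hf
  | cons i l ih => exact analyticAt_iterate_pderiv i _ ih

theorem analyticAt_mixedDeriv (β : Fin n → ℕ) (hf : AnalyticAt ℂ f x) :
    AnalyticAt ℂ (mixedDeriv β f) x := analyticAt_listDeriv _ β hf

theorem mixedDeriv_zero (f : (Fin n → ℂ) → ℂ) : mixedDeriv 0 f = f := by
  change (List.finRange n).foldr (fun i g => (pderiv i)^[(0 : Fin n → ℕ) i] g) f = f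
  induction List.finRange n with
  | nil => rfl
  | cons i l ih => simp

theorem listDeriv_add_single_of_notMem (l : List (Fin n)) (β : Fin n → ℕ) (i : Fin n)
    (hi : i ∉ l) (f : (Fin n → ℂ) → ℂ) : listDeriv l (β + Pi.single i 1) f = listDeriv l β f := by
  induction l with
  | nil => rfl
  | cons a l ih =>
    have h := List.ne_and_not_mem_of_not_mem_cons hi
    rw [listDeriv_cons, listDeriv_cons, ih h.2]
    simp [Pi.single_eq_of_ne h.1.symm]

theorem listDeriv_add_single (l : List (Fin n)) (hl : l.Nodup) (β : Fin n → ℕ) (i : Fin n)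
    (hi : i ∈ l) (hf : AnalyticAt ℂ f x) :
    listDeriv l (β + Pi.single i 1) f =ᶠ[𝓝 x] pderiv i (listDeriv l β f) := by
  induction l with
  | nil => simp at hi
  | cons a l ih =>
    rw [List.nodup_cons] at hl
    rw [listDeriv_cons, listDeriv_cons]
    by_cases h : a = i
    · subst h
      rw [listDeriv_add_single_of_notMem l β a hl.1, ← Function.iterate_succ_apply' (pderiv a)]
      simp
    · have hi' : i ∈ l := (List.mem_cons.1 hi).resolve_left (Ne.symm h)
      have e : (β + (Pi.single i 1 : Fin n → ℕ)) a = β a := by simp [Pi.single_eq_of_ne h]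
      rw [e]
      exact (iterate_pderiv_congr a _ (ih hl.2 hi')).trans
        (iterate_pderiv_comm a i _ (analyticAt_listDeriv l β hf))

/-- `mixedDeriv` differentiates in a fixed order of the variables; symmetry of second derivatives
lets the new derivative be moved outermost. This is the inductive step for every later statement
about multiindices. -/
theorem mixedDeriv_add_single (β : Fin n → ℕ) (i : Fin n) (hf : AnalyticAt ℂ f x) :
    mixedDeriv (β + Pi.single i 1) f =ᶠ[𝓝 x] pderiv i (mixedDeriv β f) :=
  listDeriv_add_single _ (List.nodup_finRange n) β i (List.mem_finRange i) hf

theorem order_add_single (β : Fin n → ℕ) (i : Fin n) :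
    order (β + Pi.single i 1) = order β + 1 := by
  simp [order, Finset.sum_add_distrib]

theorem order_single (i : Fin n) : order (Pi.single i 1 : Fin n → ℕ) = 1 := by
  simp [order]

/-- Induction on multiindices, raising one entry at a time. -/
theorem multiindex_induction {p : (Fin n → ℕ) → Prop} (h0 : p 0)
    (hs : ∀ β i, p β → p (β + Pi.single i 1)) (β : Fin n → ℕ) : p β := by
  induction h : order β generalizing β with
  | zero =>
    have : β = 0 := by
      funext i
      exact (Finset.sum_eq_zero_iff.1 h) i (Finset.mem_univ i)
    exact this ▸ h0
  | succ k ih =>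
    obtain ⟨i, hi⟩ : ∃ i, β i ≠ 0 := by
      by_contra! hc
      simp [order, hc] at h
    have e : β = Function.update β i (β i - 1) + Pi.single i 1 := by
      funext j
      by_cases hj : j = i
      · subst hj
        simp only [Pi.add_apply, Function.update_self, Pi.single_eq_same]
        omega
      · simp [hj]
    rw [e] at h ⊢
    rw [order_add_single] at h
    exact hs _ i (ih _ (by omega))

theorem mixedDeriv_congr (β : Fin n → ℕ) (hf : AnalyticAt ℂ f x) (h : f =ᶠ[𝓝 x] g) :
    mixedDeriv β f =ᶠ[𝓝 x] mixedDeriv β g := by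
  have hg : AnalyticAt ℂ g x := hf.congr h
  induction β using multiindex_induction with
  | h0 => simpa only [mixedDeriv_zero] using h
  | hs β i ih =>
    exact (mixedDeriv_add_single β i hf).trans
      ((pderiv_congr i ih).trans (mixedDeriv_add_single β i hg).symm)

theorem mixedDeriv_const (β : Fin n → ℕ) (hβ : 0 < order β) (c : ℂ) :
    mixedDeriv β (fun _ => c) =ᶠ[𝓝 x] fun _ => 0 := by
  have key : β ≠ 0 → mixedDeriv β (fun _ => c) =ᶠ[𝓝 x] fun _ => 0 := by
    clear hβ
    induction β using multiindex_induction with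
    | h0 => exact fun h => absurd rfl h
    | hs β i ih =>
      intro _
      refine (mixedDeriv_add_single β i analyticAt_const).trans ?_
      by_cases h : β = 0
      · rw [h, mixedDeriv_zero, pderiv_const]
      · refine (pderiv_congr i (ih h)).trans ?_
        rw [pderiv_const]
  exact key (by rintro rfl; simp [order] at hβ)

theorem mixedDeriv_sum {ι : Type*} (s : Finset ι) (c : ι → ℂ) (F : ι → (Fin n → ℂ) → ℂ)
    (hF : ∀ j, AnalyticAt ℂ (F j) x) (β : Fin n → ℕ) :
    mixedDeriv β (fun z => ∑ j ∈ s, c j * F j z) =ᶠ[𝓝 x]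
      fun z => ∑ j ∈ s, c j * mixedDeriv β (F j) z := by
  have hs : AnalyticAt ℂ (fun z => ∑ j ∈ s, c j * F j z) x :=
    Finset.analyticAt_fun_sum s fun j _ => analyticAt_const.mul (hF j)
  induction β using multiindex_induction with
  | h0 => simp only [mixedDeriv_zero]; rfl
  | hs β i ih =>
    refine (mixedDeriv_add_single β i hs).trans ((pderiv_congr i ih).trans ?_)
    have e1 : ∀ᶠ y in 𝓝 x, ∀ j ∈ s, mixedDeriv (β + Pi.single i 1) (F j) y =
        pderiv i (mixedDeriv β (F j)) y :=
      (Filter.eventually_all_finset s).2 fun j _ => mixedDeriv_add_single β i (hF j)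
    have e2 : ∀ᶠ y in 𝓝 x, ∀ j ∈ s, AnalyticAt ℂ (mixedDeriv β (F j)) y :=
      (Filter.eventually_all_finset s).2 fun j _ =>
        (analyticAt_mixedDeriv β (hF j)).eventually_analyticAt
    filter_upwards [e1, e2] with y h1 h2
    rw [Finset.sum_congr rfl fun j hj => by rw [h1 j hj]]
    simp only [pderiv]
    rw [fderiv_fun_sum fun j hj => ((h2 j hj).differentiableAt.const_mul (c j))]
    rw [sum_apply]
    refine Finset.sum_congr rfl fun j hj => ?_
    rw [fderiv_const_mul (h2 j hj).differentiableAt]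
    rfl

/-- The mixed derivatives in the first group of variables are analytic in both groups. -/
theorem analyticOnNhd_mixedDeriv_fst {D : Set ((Fin n → ℂ) × (Fin n → ℂ))} (hD : IsOpen D)
    {φ : (Fin n → ℂ) × (Fin n → ℂ) → ℂ} (hφ : AnalyticOnNhd ℂ φ D) (β : Fin n → ℕ) :
    AnalyticOnNhd ℂ (fun p => mixedDeriv β (fun z => φ (z, p.2)) p.1) D := by
  have hslice : ∀ (Φ : (Fin n → ℂ) × (Fin n → ℂ) → ℂ) (p), AnalyticAt ℂ Φ p →
      AnalyticAt ℂ (fun z => Φ (z, p.2)) p.1 := fun Φ p h => by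
    have : AnalyticAt ℂ (fun z : Fin n → ℂ => (z, p.2)) p.1 :=
      AnalyticAt.prod analyticAt_id analyticAt_const
    exact AnalyticAt.comp (f := fun z : Fin n → ℂ => (z, p.2)) (x := p.1) h this
  induction β using multiindex_induction with
  | h0 => simpa only [mixedDeriv_zero] using hφ
  | hs β i ih =>
    set Φ : (Fin n → ℂ) × (Fin n → ℂ) → ℂ := fun p => mixedDeriv β (fun z => φ (z, p.2)) p.1
    -- The partial derivative in z_i is the full derivative in the direction (e_i, 0), so joint
    -- analyticity is inherited.
    have e : Set.EqOn (fun p => fderiv ℂ Φ p (Pi.single i 1, 0))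
        (fun p => mixedDeriv (β + Pi.single i 1) (fun z => φ (z, p.2)) p.1) D := by
      intro p hp
      have h1 := (mixedDeriv_add_single β i (hslice φ p (hφ p hp))).self_of_nhds
      simp only [h1, pderiv]
      have h2 : HasFDerivAt (fun z : Fin n → ℂ => Φ (z, p.2))
          ((fderiv ℂ Φ p).comp (ContinuousLinearMap.inl ℂ (Fin n → ℂ) (Fin n → ℂ))) p.1 :=
        HasFDerivAt.comp (f := fun z : Fin n → ℂ => (z, p.2)) p.1
          (ih p hp).differentiableAt.hasFDerivAt (hasFDerivAt_prodMk_left p.1 p.2)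
      have h3 := h2.fderiv
      change _ = (fderiv ℂ (fun z : Fin n → ℂ => Φ (z, p.2)) p.1) _
      rw [h3]
      simp
    refine AnalyticOnNhd.congr hD (fun p hp => ?_) e
    exact (ContinuousLinearMap.apply ℂ ℂ
      ((Pi.single i (1 : ℂ), 0) : (Fin n → ℂ) × (Fin n → ℂ))).analyticAt _ |>.comp (ih p hp).fderiv

end Calculus

end Rigid

namespace Rigid

/-! ### Weights of polynomials in the jet variables. -/

namespace JetPoly

variable {n k : ℕ} {P Q : JetPoly n k} {d e : ℕ}

theorem wt_le_iff : P.wt ≤ d ↔ ∀ μ ∈ P.support, Finsupp.weight varWeight μ ≤ d :=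
  Finset.sup_le_iff

theorem wt_C_le (c : ℂ) : wt (MvPolynomial.C c : JetPoly n k) ≤ d := by
  classical
  refine wt_le_iff.2 fun μ hμ => ?_
  have : μ = 0 := by
    by_contra h
    rw [MvPolynomial.mem_support_iff, MvPolynomial.coeff_C, if_neg (Ne.symm h)] at hμ
    exact hμ rfl
  simp [this]

theorem wt_X_le (β : LowerIndex n k) : wt (MvPolynomial.X β : JetPoly n k) ≤ varWeight β := by
  refine wt_le_iff.2 fun μ hμ => ?_
  rw [MvPolynomial.support_X, Finset.mem_singleton] at hμ
  simp [hμ, Finsupp.weight_single]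

theorem wt_add_le (hP : P.wt ≤ d) (hQ : Q.wt ≤ d) : wt (P + Q : JetPoly n k) ≤ d := by
  classical
  rw [wt_le_iff] at *
  intro μ hμ
  exact (Finset.mem_union.1 (MvPolynomial.support_add hμ)).elim (hP μ) (hQ μ)

theorem wt_mul_le (hP : P.wt ≤ d) (hQ : Q.wt ≤ e) : wt (P * Q : JetPoly n k) ≤ d + e := by
  classical
  rw [wt_le_iff] at *
  intro μ hμ
  obtain ⟨a, ha, b, hb, rfl⟩ := Finset.mem_add.1 (MvPolynomial.support_mul P Q hμ)
  rw [map_add]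
  exact add_le_add (hP a ha) (hQ b hb)

theorem wt_neg_le (hP : P.wt ≤ d) : wt (-P : JetPoly n k) ≤ d := by
  rw [wt_le_iff] at *
  simpa only [MvPolynomial.support_neg] using hP

theorem wt_zero_le : wt (0 : JetPoly n k) ≤ d := wt_le_iff.2 (by simp)

theorem wt_one_le : wt (1 : JetPoly n k) ≤ d := wt_C_le 1

theorem wt_sum_le {ι : Type*} (s : Finset ι) (F : ι → JetPoly n k) (h : ∀ i ∈ s, (F i).wt ≤ d) :
    wt (∑ i ∈ s, F i : JetPoly n k) ≤ d := by
  classical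
  induction s using Finset.induction_on with
  | empty => simpa using wt_zero_le
  | insert a s ha ih =>
    rw [Finset.sum_insert ha]
    exact wt_add_le (h a (Finset.mem_insert_self a s))
      (ih fun i hi => h i (Finset.mem_insert_of_mem hi))

theorem wt_prod_le {ι : Type*} (s : Finset ι) (F : ι → JetPoly n k) (δ : ι → ℕ)
    (h : ∀ i ∈ s, (F i).wt ≤ δ i) : wt (∏ i ∈ s, F i : JetPoly n k) ≤ ∑ i ∈ s, δ i := by
  classical
  induction s using Finset.induction_on with
  | empty => rw [Finset.prod_empty]; exact wt_one_le
  | insert a s ha ih =>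
    rw [Finset.prod_insert ha, Finset.sum_insert ha]
    exact wt_mul_le (h a (Finset.mem_insert_self a s))
      (ih fun i hi => h i (Finset.mem_insert_of_mem hi))

/-- The weight of a determinant is bounded by the sum of the weights of its columns. -/
theorem wt_det_le {κ : Type*} [Fintype κ] [DecidableEq κ] (A : Matrix κ κ (JetPoly n k))
    (δ : κ → ℕ) (h : ∀ i j, (A i j).wt ≤ δ j) : wt A.det ≤ ∑ j, δ j := by
  rw [Matrix.det_apply]
  refine wt_sum_le _ _ fun σ _ => ?_
  have hp : wt (∏ i, A (σ i) i : JetPoly n k) ≤ ∑ j, δ j := wt_prod_le _ _ _ fun i _ => h _ i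
  rcases Int.units_eq_one_or (Equiv.Perm.sign σ) with hσ | hσ
  · rw [hσ, one_smul]; exact hp
  · rw [hσ, Units.neg_smul, one_smul]; exact wt_neg_le hp

end JetPoly

/-! ### Differential polynomials and the weighted chain rule. -/

section DiffPoly

variable {n : ℕ} {Ξ : Type*}

/-- Differential polynomials in a family of germs `φ ξ` at the origin, with coefficients that are
analytic functions of `z` and `c (φ ξ z - φ ξ 0)`. Only derivatives of order less than `k` occur,
and the weight is at most `d` if `∂^β φ` is given the weight `2|β| - 1`. -/
inductive IsDiffPoly (c : ℂ) (φ : Ξ → (Fin n → ℂ) → ℂ) :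
    ℕ → ℕ → (Ξ → (Fin n → ℂ) → ℂ) → Prop
  | comp {k d : ℕ} (h : (Fin n → ℂ) × ℂ → ℂ) (hh : AnalyticAt ℂ h (0, 0)) (hk : 1 ≤ k) :
      IsDiffPoly c φ k d (fun ξ z => h (z, c * (φ ξ z - φ ξ 0)))
  | jet {k d : ℕ} (β : Fin n → ℕ) (h0 : 0 < order β) (hk : order β < k)
      (hd : 2 * order β - 1 ≤ d) : IsDiffPoly c φ k d (fun ξ => mixedDeriv β (φ ξ))
  | add {k d : ℕ} {F G : Ξ → (Fin n → ℂ) → ℂ} (hF : IsDiffPoly c φ k d F)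
      (hG : IsDiffPoly c φ k d G) : IsDiffPoly c φ k d (fun ξ z => F ξ z + G ξ z)
  | mul {k d e : ℕ} {F G : Ξ → (Fin n → ℂ) → ℂ} (hF : IsDiffPoly c φ k d F)
      (hG : IsDiffPoly c φ k e G) : IsDiffPoly c φ k (d + e) (fun ξ z => F ξ z * G ξ z)
  | mono {k d k' d' : ℕ} {F : Ξ → (Fin n → ℂ) → ℂ} (hF : IsDiffPoly c φ k d F) (hk : k ≤ k')
      (hd : d ≤ d') : IsDiffPoly c φ k' d' F
  | congr {k d : ℕ} {F G : Ξ → (Fin n → ℂ) → ℂ} (hF : IsDiffPoly c φ k d F)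
      (h : ∀ ξ, F ξ =ᶠ[𝓝 0] G ξ) : IsDiffPoly c φ k d G

variable {c : ℂ} {φ : Ξ → (Fin n → ℂ) → ℂ}

theorem analyticAt_comp_graph {f : (Fin n → ℂ) → ℂ} (hf : AnalyticAt ℂ f 0)
    {E : Type*} [NormedAddCommGroup E] [NormedSpace ℂ E]
    {h : (Fin n → ℂ) × ℂ → E} (hh : AnalyticAt ℂ h (0, 0)) :
    AnalyticAt ℂ (fun z => h (z, c * (f z - f 0))) 0 := by
  have h1 : AnalyticAt ℂ (fun z => (z, c * (f z - f 0))) (0 : Fin n → ℂ) :=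
    AnalyticAt.prod analyticAt_id (analyticAt_const.mul (hf.sub analyticAt_const))
  exact AnalyticAt.comp_of_eq hh h1 (by simp)

/-- The chain rule along the graph of `c (f - f 0)`. -/
theorem fderiv_comp_graph {f : (Fin n → ℂ) → ℂ} (hf : AnalyticAt ℂ f 0)
    {E : Type*} [NormedAddCommGroup E] [NormedSpace ℂ E] [CompleteSpace E]
    {h : (Fin n → ℂ) × ℂ → E} (hh : AnalyticAt ℂ h (0, 0)) :
    ∀ᶠ z in 𝓝 (0 : Fin n → ℂ), ∀ v, fderiv ℂ (fun z => h (z, c * (f z - f 0))) z v =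
      fderiv ℂ h (z, c * (f z - f 0)) (v, 0) +
        (c * fderiv ℂ f z v) • fderiv ℂ h (z, c * (f z - f 0)) (0, 1) := by
  have h1 : AnalyticAt ℂ (fun z => (z, c * (f z - f 0))) (0 : Fin n → ℂ) :=
    AnalyticAt.prod analyticAt_id (analyticAt_const.mul (hf.sub analyticAt_const))
  have h2 : ∀ᶠ z in 𝓝 (0 : Fin n → ℂ), AnalyticAt ℂ h (z, c * (f z - f 0)) := by
    have := h1.continuousAt.tendsto
    simp only [sub_self, mul_zero] at this
    exact this.eventually hh.eventually_analyticAt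
  filter_upwards [h2, hf.eventually_analyticAt] with z hz hfz v
  have e1 : HasFDerivAt (fun z => (z, c * (f z - f 0)))
      ((ContinuousLinearMap.id ℂ (Fin n → ℂ)).prod (c • fderiv ℂ f z)) z :=
    (hasFDerivAt_id z).prodMk ((hfz.differentiableAt.hasFDerivAt.sub_const _).const_mul c)
  have e2 := (hz.differentiableAt.hasFDerivAt.comp z e1).fderiv
  change fderiv ℂ (h ∘ fun z => (z, c * (f z - f 0))) z v = _
  rw [e2]
  have e3 : ((v, c * fderiv ℂ f z v) : (Fin n → ℂ) × ℂ) = (v, 0) + (c * fderiv ℂ f z v) • (0, 1) := by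
    simp
  simp only [ContinuousLinearMap.comp_apply, ContinuousLinearMap.prod_apply,
    ContinuousLinearMap.id_apply, smul_apply, smul_eq_mul]
  rw [e3, map_add, map_smul]

theorem analyticAt_fderiv_apply {E F : Type*} [NormedAddCommGroup E] [NormedSpace ℂ E]
    [NormedAddCommGroup F] [NormedSpace ℂ F] [CompleteSpace F] {h : E → F} {x : E}
    (hh : AnalyticAt ℂ h x) (v : E) : AnalyticAt ℂ (fun p => fderiv ℂ h p v) x :=
  (ContinuousLinearMap.apply ℂ F v).analyticAt _ |>.comp hh.fderiv

theorem IsDiffPoly.analyticAt (hφ : ∀ ξ, AnalyticAt ℂ (φ ξ) 0) {k d : ℕ}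
    {F : Ξ → (Fin n → ℂ) → ℂ} (hF : IsDiffPoly c φ k d F) (ξ : Ξ) : AnalyticAt ℂ (F ξ) 0 := by
  induction hF with
  | comp h hh hk => exact analyticAt_comp_graph (hφ ξ) hh
  | jet β h0 hk hd => exact analyticAt_mixedDeriv β (hφ ξ)
  | add _ _ ihF ihG => exact ihF.add ihG
  | mul _ _ ihF ihG => exact ihF.mul ihG
  | mono _ _ _ ih => exact ih
  | congr _ h ih => exact ih.congr (h ξ)

theorem mixedDeriv_single (hφ : ∀ ξ, AnalyticAt ℂ (φ ξ) 0) (i : Fin n) (ξ : Ξ) :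
    mixedDeriv (Pi.single i 1) (φ ξ) =ᶠ[𝓝 0] pderiv i (φ ξ) := by
  have := mixedDeriv_add_single 0 i (hφ ξ)
  rwa [zero_add, mixedDeriv_zero] at this

theorem pderiv_comp_graph (hφ : ∀ ξ, AnalyticAt ℂ (φ ξ) 0) {h : (Fin n → ℂ) × ℂ → ℂ}
    (hh : AnalyticAt ℂ h (0, 0)) (i : Fin n) (ξ : Ξ) :
    pderiv i (fun z => h (z, c * (φ ξ z - φ ξ 0))) =ᶠ[𝓝 0] fun z =>
      c * fderiv ℂ h (z, c * (φ ξ z - φ ξ 0)) (0, 1) * mixedDeriv (Pi.single i 1) (φ ξ) z +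
        fderiv ℂ h (z, c * (φ ξ z - φ ξ 0)) (Pi.single i 1, 0) := by
  filter_upwards [fderiv_comp_graph (c := c) (hφ ξ) hh, mixedDeriv_single hφ i ξ] with z h1 h2
  rw [h2]
  simp only [pderiv]
  rw [h1, smul_eq_mul]
  ring

/-- A jet gains exactly 2 in weight. A coefficient produces at worst one factor φ_{z_i}, of weight
1; the condition 1 ≤ k on coefficients makes room for this first-order jet below k + 1. -/
theorem IsDiffPoly.pderiv (hφ : ∀ ξ, AnalyticAt ℂ (φ ξ) 0) {k d : ℕ}
    {F : Ξ → (Fin n → ℂ) → ℂ} (hF : IsDiffPoly c φ k d F) (i : Fin n) :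
    IsDiffPoly c φ (k + 1) (d + 2) (fun ξ => Rigid.pderiv i (F ξ)) := by
  induction hF with
  | @comp k d h hh hk =>
    refine IsDiffPoly.congr ?_ fun ξ => (pderiv_comp_graph hφ hh i ξ).symm
    refine IsDiffPoly.add (IsDiffPoly.mul (d := d + 1) (e := 1) ?_ ?_) ?_
    · exact .comp (fun p => c * fderiv ℂ h p (0, 1))
        (analyticAt_const.mul (analyticAt_fderiv_apply hh _)) (by omega)
    · exact .jet _ (by rw [order_single]; omega) (by rw [order_single]; omega)
        (by rw [order_single])
    · exact .comp (fun p => fderiv ℂ h p (Pi.single i 1, 0)) (analyticAt_fderiv_apply hh _)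
        (by omega)
  | jet β h0 hk hd =>
    refine IsDiffPoly.congr ?_ fun ξ => mixedDeriv_add_single β i (hφ ξ)
    exact .jet _ (by rw [order_add_single]; omega) (by rw [order_add_single]; omega)
      (by rw [order_add_single]; omega)
  | add hF hG ihF ihG =>
    exact (ihF.add ihG).congr fun ξ => (pderiv_add i (hF.analyticAt hφ ξ) (hG.analyticAt hφ ξ)).symm
  | @mul k d e F G hF hG ihF ihG =>
    refine IsDiffPoly.congr ?_ fun ξ =>
      (pderiv_mul i (hF.analyticAt hφ ξ) (hG.analyticAt hφ ξ)).symm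
    exact ((ihF.mul (hG.mono (Nat.le_succ k) le_rfl)).mono le_rfl (by omega)).add
      (((hF.mono (Nat.le_succ k) le_rfl).mul ihG).mono le_rfl (by omega))
  | mono _ hk hd ih => exact ih.mono (by omega) (by omega)
  | congr _ h ih => exact ih.congr fun ξ => pderiv_congr i (h ξ)

/-- In a derivative of order `|α|` of `h (z, c (φ - φ 0))` the derivative `∂^α φ` occurs only in the
term `c h_w ∂^α φ`, and the rest has weight at most `2|α| - 2`. -/
theorem exists_mixedDeriv_comp_eq (hφ : ∀ ξ, AnalyticAt ℂ (φ ξ) 0) {h : (Fin n → ℂ) × ℂ → ℂ}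
    (hh : AnalyticAt ℂ h (0, 0)) (α : Fin n → ℕ) (hα : 0 < order α) :
    ∃ F, IsDiffPoly c φ (order α) (2 * order α - 2) F ∧ ∀ ξ,
      mixedDeriv α (fun z => h (z, c * (φ ξ z - φ ξ 0))) =ᶠ[𝓝 0] fun z =>
        c * fderiv ℂ h (z, c * (φ ξ z - φ ξ 0)) (0, 1) * mixedDeriv α (φ ξ) z + F ξ z := by
  have hcomp := fun ξ => analyticAt_comp_graph (c := c) (hφ ξ) hh
  induction α using multiindex_induction with
  | h0 => simp [order] at hα
  | hs β i ih =>
    by_cases hβ : 0 < order β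
    · obtain ⟨F, hF, hFe⟩ := ih hβ
      have hw : AnalyticAt ℂ (fun p => c * fderiv ℂ h p (0, 1)) (0, 0) :=
        analyticAt_const.mul (analyticAt_fderiv_apply hh _)
      have hu : IsDiffPoly c φ 1 0 (fun ξ z => c * fderiv ℂ h (z, c * (φ ξ z - φ ξ 0)) (0, 1)) :=
        .comp _ hw le_rfl
      have hj : IsDiffPoly c φ (order β + 1) (2 * order β - 1) (fun ξ => mixedDeriv β (φ ξ)) :=
        .jet β hβ (Nat.lt_succ_self _) le_rfl
      -- The general rule would give weight 2 here. The sharp weight 1 is needed: multiplied by ∂^β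
      -- φ it gives 1 + (2|β| − 1) = 2(|β| + 1) − 2.
      have hu' : IsDiffPoly c φ 2 1 (fun ξ => Rigid.pderiv i
          (fun z => c * fderiv ℂ h (z, c * (φ ξ z - φ ξ 0)) (0, 1))) := by
        refine IsDiffPoly.congr ?_ fun ξ => (pderiv_comp_graph hφ hw i ξ).symm
        refine IsDiffPoly.add (IsDiffPoly.mul (d := 0) (e := 1) ?_ ?_) ?_
        · exact .comp (fun p => c * fderiv ℂ (fun p => c * fderiv ℂ h p (0, 1)) p (0, 1))
            (analyticAt_const.mul (analyticAt_fderiv_apply hw _)) (by omega)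
        · exact .jet _ (by rw [order_single]; omega) (by rw [order_single]; omega)
            (by rw [order_single])
        · exact .comp (fun p => fderiv ℂ (fun p => c * fderiv ℂ h p (0, 1)) p (Pi.single i 1, 0))
            (analyticAt_fderiv_apply hw _) (by omega)
      refine ⟨_, .add (((hu'.mono (by omega) le_rfl).mul hj).mono
        (k' := order (β + Pi.single i 1)) (d' := 2 * order (β + Pi.single i 1) - 2)
        (by rw [order_add_single]) (by rw [order_add_single]; omega))
        ((hF.pderiv hφ i).mono (by rw [order_add_single]) (by rw [order_add_single]; omega)),
        fun ξ => ?_⟩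
      refine (mixedDeriv_add_single β i (hcomp ξ)).trans ((pderiv_congr i (hFe ξ)).trans ?_)
      refine (pderiv_add i ((hu.analyticAt hφ ξ).fun_mul (hj.analyticAt hφ ξ))
        (hF.analyticAt hφ ξ)).trans ?_
      filter_upwards [pderiv_mul i (hu.analyticAt hφ ξ) (hj.analyticAt hφ ξ),
        mixedDeriv_add_single β i (hφ ξ)] with z h1 h2
      rw [h1, h2]
      ring
    · have : β = 0 := by
        funext j
        exact (Finset.sum_eq_zero_iff.1 (Nat.eq_zero_of_not_pos hβ)) j (Finset.mem_univ j)
      subst this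
      refine ⟨fun ξ z => fderiv ℂ h (z, c * (φ ξ z - φ ξ 0)) (Pi.single i 1, 0),
        .comp (fun p => fderiv ℂ h p (Pi.single i 1, 0)) (analyticAt_fderiv_apply hh _)
        hα, fun ξ => ?_⟩
      refine (mixedDeriv_add_single 0 i (hcomp ξ)).trans ?_
      rw [mixedDeriv_zero, zero_add]
      exact pderiv_comp_graph hφ hh i ξ

/-- The value at the origin of a differential polynomial is a polynomial in the jets. -/
theorem IsDiffPoly.exists_jetPoly {k d : ℕ} {F : Ξ → (Fin n → ℂ) → ℂ}
    (hF : IsDiffPoly c φ k d F) {K : ℕ} (hK : k ≤ K) : ∃ q : JetPoly n K, q.wt ≤ d ∧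
      ∀ ξ, F ξ 0 = MvPolynomial.eval (fun β : LowerIndex n K => mixedDeriv β.1 (φ ξ) 0) q := by
  induction hF with
  -- At z = 0 the graph passes through the origin for every ξ, so coefficients become constants
  -- independent of ξ.
  | comp h hh hk => exact ⟨MvPolynomial.C (h (0, 0)), JetPoly.wt_C_le _, fun ξ => by simp⟩
  | jet β h0 hk hd =>
    exact ⟨MvPolynomial.X ⟨β, h0, hk.trans_le hK⟩, (JetPoly.wt_X_le _).trans hd, fun ξ => by simp⟩
  | add _ _ ihF ihG =>
    obtain ⟨p, hp, hp'⟩ := ihF hK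
    obtain ⟨q, hq, hq'⟩ := ihG hK
    exact ⟨p + q, JetPoly.wt_add_le hp hq, fun ξ => by rw [map_add, ← hp', ← hq']⟩
  | mul _ _ ihF ihG =>
    obtain ⟨p, hp, hp'⟩ := ihF hK
    obtain ⟨q, hq, hq'⟩ := ihG hK
    exact ⟨p * q, JetPoly.wt_mul_le hp hq, fun ξ => by rw [map_mul, ← hp', ← hq']⟩
  | mono _ hk hd ih =>
    obtain ⟨p, hp, hp'⟩ := ih (hk.trans hK)
    exact ⟨p, hp.trans hd, hp'⟩
  | congr _ h ih =>
    obtain ⟨p, hp, hp'⟩ := ih hK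
    exact ⟨p, hp, fun ξ => by rw [← hp', (h ξ).self_of_nhds]⟩

end DiffPoly

end Rigid

namespace Rigid

/-! ### Identity theorem on a totally real subspace. -/

section Complexification

/-- A holomorphic function that vanishes at the real points near the origin, with respect to an
antilinear isometric involution, vanishes near the origin. -/
theorem eventually_eq_zero_of_vanish_on_real_points {E : Type*} [NormedAddCommGroup E]
    [NormedSpace ℂ E] (σ : E →ₗ⋆[ℂ] E) (hσ : ∀ x, σ (σ x) = x) (hn : ∀ x, ‖σ x‖ = ‖x‖)
    {G : E → ℂ} (hG : ∀ᶠ x in 𝓝 0, DifferentiableAt ℂ G x)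
    (h0 : ∀ᶠ x in 𝓝 0, σ x = x → G x = 0) : ∀ᶠ x in 𝓝 0, G x = 0 := by
  obtain ⟨ε, hε, hball⟩ := Metric.eventually_nhds_iff_ball.1 (hG.and h0)
  -- Split x = a + i b with a, b fixed by σ and of norm at most ‖x‖. On the complex line t ↦ a + t b
  -- the function vanishes for small real t, hence at t = i. The disc |t| < 2 contains i and needs
  -- ‖a‖ + 2‖b‖ < ε, whence ε / 3.
  refine Metric.eventually_nhds_iff_ball.2 ⟨ε / 3, by positivity, fun x hx => ?_⟩
  rw [mem_ball_zero_iff] at hx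
  obtain ⟨a, a_def⟩ : ∃ a : E, a = (1 / 2 : ℂ) • (x + σ x) := ⟨_, rfl⟩
  obtain ⟨b, b_def⟩ : ∃ b : E, b = (1 / (2 * Complex.I)) • (x - σ x) := ⟨_, rfl⟩
  have c2 : starRingEnd ℂ 2 = 2 := map_ofNat _ 2
  have ha : σ a = a := by
    rw [a_def, LinearMap.map_smulₛₗ, map_add, hσ, add_comm (σ x)]
    simp [c2]
  have hb : σ b = b := by
    rw [b_def, LinearMap.map_smulₛₗ, map_sub, hσ]
    rw [← neg_sub x (σ x), smul_neg, ← neg_smul]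
    congr 1
    simp [c2]
  have hna : ‖a‖ ≤ ‖x‖ := by
    rw [a_def, norm_smul]
    have := norm_add_le x (σ x)
    rw [hn] at this
    norm_num
    linarith
  have hnb : ‖b‖ ≤ ‖x‖ := by
    rw [b_def, norm_smul]
    have := norm_sub_le x (σ x)
    rw [hn] at this
    norm_num
    linarith
  have hmem : ∀ t : ℂ, t ∈ Metric.ball (0 : ℂ) 2 → a + t • b ∈ Metric.ball (0 : E) ε := by
    intro t ht
    rw [mem_ball_zero_iff] at ht ⊢
    have h1 := norm_add_le a (t • b)
    rw [norm_smul] at h1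
    have h2 : ‖t‖ * ‖b‖ ≤ 2 * ‖x‖ := mul_le_mul ht.le hnb (norm_nonneg _) (by norm_num)
    linarith
  have hd : DifferentiableOn ℂ (fun t : ℂ => G (a + t • b)) (Metric.ball 0 2) := by
    intro t ht
    have h1 := (hball _ (hmem t ht)).1
    have h2 : DifferentiableAt ℂ (fun t : ℂ => a + t • b) t := by fun_prop
    exact (DifferentiableAt.comp t h1 h2).differentiableWithinAt
  have hfreq : ∃ᶠ t in 𝓝[≠] (0 : ℂ), G (a + t • b) = 0 := by
    have ht : Filter.Tendsto (fun r : ℝ => (r : ℂ)) (𝓝[≠] 0) (𝓝[≠] 0) := by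
      refine tendsto_nhdsWithin_of_tendsto_nhds_of_eventually_within _ ?_ ?_
      · have := Complex.continuous_ofReal.tendsto (0 : ℝ)
        rw [Complex.ofReal_zero] at this
        exact this.mono_left nhdsWithin_le_nhds
      · filter_upwards [self_mem_nhdsWithin] with r hr
        simpa using hr
    refine ht.frequently (Filter.Eventually.frequently ?_)
    have : ∀ᶠ r : ℝ in 𝓝[≠] 0, (r : ℂ) ∈ Metric.ball (0 : ℂ) 2 :=
      (ht.mono_right nhdsWithin_le_nhds).eventually (Metric.ball_mem_nhds 0 (by norm_num))
    filter_upwards [this] with r hr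
    refine (hball _ (hmem _ hr)).2 ?_
    rw [map_add, LinearMap.map_smulₛₗ, ha, hb, Complex.conj_ofReal]
  have hz := (hd.analyticOnNhd Metric.isOpen_ball).eqOn_zero_of_preconnected_of_frequently_eq_zero
    (convex_ball (0 : ℂ) 2).isPreconnected (Metric.mem_ball_self (by norm_num)) hfreq
  have hI : Complex.I ∈ Metric.ball (0 : ℂ) 2 := by simp
  have := hz hI
  have e : a + Complex.I • b = x := by
    simp only [a_def, b_def, smul_smul]
    have : Complex.I * (1 / (2 * Complex.I)) = 1 / 2 := by field_simp
    rw [this, ← smul_add, add_add_sub_cancel, ← two_smul ℂ x, smul_smul]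
    norm_num
  simpa [e] using this

end Complexification

/-! ### Polarized equation and differential of a hyperquadric. -/

namespace Hyperquadric

variable {d : ℕ} (X : Hyperquadric d)

/-- The complexified defining function `w - 2 i h(z, ū)`, as a linear form in `(z, w)`; the point
`u` enters antiholomorphically. -/
noncomputable def polar (u : (Fin d → ℂ) × ℂ) : ((Fin d → ℂ) × ℂ) →ₗ[ℂ] ℂ :=
  LinearMap.snd ℂ (Fin d → ℂ) ℂ ∘ₗ X.coords.toLinearEquiv.toLinearMap -
    (2 * Complex.I) • (dotProductBilin ℂ ℂ (star (X.coords u).1) ∘ₗ X.form.mulVecLin ∘ₗ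
      LinearMap.fst ℂ (Fin d → ℂ) ℂ ∘ₗ X.coords.toLinearEquiv.toLinearMap)

theorem polar_apply (u v : (Fin d → ℂ) × ℂ) : X.polar u v = (X.coords v).2 -
    2 * Complex.I * (star (X.coords u).1 ⬝ᵥ (X.form.mulVec (X.coords v).1)) := rfl

/-- On the diagonal the polarized equation is 2i times the real one, since a hermitian form is real
there. -/
theorem polar_self (p : (Fin d → ℂ) × ℂ) :
    X.polar p p - star (X.coords p).2 = 2 * Complex.I * X.definingFunction p := by
  have h : (star (X.coords p).1 ⬝ᵥ (X.form.mulVec (X.coords p).1)).im = 0 :=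
    X.isHermitian.im_star_dotProduct_mulVec_self _
  rw [polar_apply, definingFunction]
  apply Complex.ext
  · simp [h]
  · simp [h]
    ring

theorem differentiable_definingFunction : Differentiable ℝ X.definingFunction := by
  have hL : Differentiable ℝ fun p => X.coords p :=
    (X.coords.toContinuousLinearMap.restrictScalars ℝ).differentiable
  have h1 : Differentiable ℝ fun p => (X.coords p).2 := hL.snd
  have h2 : ∀ j, Differentiable ℝ fun p => (X.coords p).1 j := differentiable_pi.1 hL.fst
  unfold definingFunction
  refine (Complex.imCLM.differentiable.comp h1).sub (Complex.reCLM.differentiable.comp ?_)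
  simp only [dotProduct, Matrix.mulVec]
  refine Differentiable.fun_sum fun j _ => ?_
  refine Differentiable.mul ?_ (Differentiable.fun_sum fun k _ => (differentiable_const _).mul (h2 k))
  exact Complex.conjCLE.toContinuousLinearMap.differentiable.comp (h2 j)

/-- Along a real line the defining function is a quadratic polynomial in t, and hermitian symmetry
identifies its linear coefficient. Consequently a vector killed by the polar form is tangent to the
hyperquadric. -/
theorem fderiv_definingFunction (p v : (Fin d → ℂ) × ℂ) :
    fderiv ℝ X.definingFunction p v = (X.polar p v).im := by
  have h1 : HasDerivAt (fun t : ℝ => X.definingFunction (p + t • v))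
      (fderiv ℝ X.definingFunction p v) 0 := by
    have e : HasDerivAt (fun t : ℝ => p + t • v) v 0 := by
      simpa using ((hasDerivAt_id (0 : ℝ)).smul_const v).const_add p
    refine HasFDerivAt.comp_hasDerivAt_of_eq (0 : ℝ)
      (X.differentiable_definingFunction p).hasFDerivAt e (by simp)
  set c := (star (X.coords v).1 ⬝ᵥ (X.form.mulVec (X.coords v).1)).re
  have hs : (star (X.coords v).1 ⬝ᵥ (X.form.mulVec (X.coords p).1)).re =
      (star (X.coords p).1 ⬝ᵥ (X.form.mulVec (X.coords v).1)).re := by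
    have : star (star (X.coords p).1 ⬝ᵥ (X.form.mulVec (X.coords v).1)) =
        star (X.coords v).1 ⬝ᵥ (X.form.mulVec (X.coords p).1) := by
      rw [Matrix.star_dotProduct, Matrix.star_mulVec, X.isHermitian.eq, star_star,
        Matrix.dotProduct_mulVec]
    rw [← this]
    exact Complex.conj_re _
  have h2 : ∀ t : ℝ, X.definingFunction (p + t • v) =
      X.definingFunction p + t * (X.polar p v).im - t ^ 2 * c := by
    intro t
    have ht : t • v = (t : ℂ) • v := by simp
    simp only [definingFunction, polar_apply, c, ht, map_add, map_smul, Prod.fst_add, Prod.snd_add,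
      Prod.smul_fst, Prod.smul_snd, Matrix.mulVec_add, Matrix.mulVec_smul, star_add, star_smul,
      add_dotProduct, dotProduct_add, smul_dotProduct, dotProduct_smul]
    simp [hs]
    ring
  have h3 : HasDerivAt (fun t : ℝ => X.definingFunction (p + t • v)) (X.polar p v).im 0 := by
    simp only [h2]
    have := (((hasDerivAt_id (0 : ℝ)).mul_const (X.polar p v).im).const_add
      (X.definingFunction p)).fun_sub (((hasDerivAt_id (0 : ℝ)).pow 2).mul_const c)
    simpa using this
  exact h1.unique h3

end Hyperquadric
end Rigid

/-! ### Polarizing H(M) ⊆ X and extracting the linear forms. -/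

namespace Rigid

/-- The involution `(z, χ, s) ↦ (χ̄, z̄, s̄)`, whose fixed points are the `(z, z̄, s)` with `s` real. -/
noncomputable def swapConj (n : ℕ) :
    (((Fin n → ℂ) × (Fin n → ℂ)) × ℂ) →ₗ⋆[ℂ] (((Fin n → ℂ) × (Fin n → ℂ)) × ℂ) where
  toFun x := ((star x.1.2, star x.1.1), star x.2)
  map_add' x y := by simp
  map_smul' c x := by
    ext <;> simp

theorem swapConj_apply {n : ℕ} (x : ((Fin n → ℂ) × (Fin n → ℂ)) × ℂ) :
    swapConj n x = ((star x.1.2, star x.1.1), star x.2) := rfl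

section Polarization

variable {n d : ℕ} {X : Hyperquadric d} {H : (Fin n → ℂ) × ℂ → (Fin d → ℂ) × ℂ}
  {φ : (Fin n → ℂ) × (Fin n → ℂ) → ℂ}

/-- The equation `H(M) ⊆ X` holds with `z` and `z̄` replaced by independent variables. -/
theorem eventually_polar_eq (hH : AnalyticAt ℂ H (0, 0)) (hφ : AnalyticAt ℂ φ (0, 0))
    (hφ0 : φ (0, 0) = 0) (hreal : ∀ᶠ z in 𝓝 (0 : Fin n → ℂ), (φ (z, star z)).im = 0)
    (hM : ∀ᶠ p in 𝓝 ((0, 0) : (Fin n → ℂ) × ℂ),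
      (p.2.im : ℂ) = φ (p.1, star p.1) → X.definingFunction (H p) = 0) :
    ∀ᶠ x : ((Fin n → ℂ) × (Fin n → ℂ)) × ℂ in 𝓝 0,
      X.polar (H (star (x.1.2, x.2 - Complex.I * φ x.1))) (H (x.1.1, x.2 + Complex.I * φ x.1)) =
        star (X.coords (H (star (x.1.2, x.2 - Complex.I * φ x.1)))).2 := by
  set p : ((Fin n → ℂ) × (Fin n → ℂ)) × ℂ → (Fin n → ℂ) × ℂ :=
    fun x => (x.1.1, x.2 + Complex.I * φ x.1)
  set q : ((Fin n → ℂ) × (Fin n → ℂ)) × ℂ → (Fin n → ℂ) × ℂ :=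
    fun x => (x.1.2, x.2 - Complex.I * φ x.1)
  have hφd : ∀ᶠ x : ((Fin n → ℂ) × (Fin n → ℂ)) × ℂ in 𝓝 0, DifferentiableAt ℂ φ x.1 := by
    have : Filter.Tendsto (fun x : ((Fin n → ℂ) × (Fin n → ℂ)) × ℂ => x.1) (𝓝 0) (𝓝 (0, 0)) :=
      continuous_fst.tendsto _
    exact (this.eventually hφ.eventually_analyticAt).mono fun x hx => hx.differentiableAt
  have hφd' : ∀ᶠ x : ((Fin n → ℂ) × (Fin n → ℂ)) × ℂ in 𝓝 0,
      DifferentiableAt ℂ (fun x : ((Fin n → ℂ) × (Fin n → ℂ)) × ℂ => φ x.1) x :=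
    hφd.mono fun x hx => DifferentiableAt.comp x hx differentiableAt_fst
  have hpd : ∀ᶠ x in 𝓝 0, DifferentiableAt ℂ p x := hφd'.mono fun x hx =>
    differentiableAt_fst.fst.prodMk (differentiableAt_snd.add (hx.const_mul _))
  have hqd : ∀ᶠ x in 𝓝 0, DifferentiableAt ℂ q x := hφd'.mono fun x hx =>
    differentiableAt_fst.snd.prodMk (differentiableAt_snd.sub (hx.const_mul _))
  have hp0 : p 0 = (0, 0) := by
    change ((0 : Fin n → ℂ), (0 : ℂ) + Complex.I * φ (0, 0)) = _
    simp [hφ0]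
  have hq0 : star (q 0) = (0, 0) := by
    change star ((0 : Fin n → ℂ), (0 : ℂ) - Complex.I * φ (0, 0)) = _
    simp [hφ0, Prod.ext_iff]
  have hpt : Filter.Tendsto p (𝓝 0) (𝓝 (0, 0)) := by
    rw [← hp0]; exact hpd.self_of_nhds.continuousAt
  have hqt : Filter.Tendsto (fun x => star (q x)) (𝓝 0) (𝓝 (0, 0)) := by
    rw [← hq0]; exact hqd.self_of_nhds.continuousAt.star
  have hHe := hH.eventually_analyticAt
  have hL : Differentiable ℂ fun v => X.coords v := X.coords.differentiable
  have hG : ∀ᶠ x in 𝓝 0, DifferentiableAt ℂ (fun x => X.polar (H (star (q x))) (H (p x)) -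
      star (X.coords (H (star (q x)))).2) x := by
    filter_upwards [hpd, hqd, hpt.eventually hHe, hqt.eventually hHe] with x h1 h2 h3 h4
    have e1 : DifferentiableAt ℂ (fun x => X.coords (H (p x))) x :=
      DifferentiableAt.comp x (hL _) (DifferentiableAt.comp x h3.differentiableAt h1)
    have e2 : DifferentiableAt ℂ (fun v => X.coords (H v)) (star (q x)) :=
      DifferentiableAt.comp _ (hL _) h4.differentiableAt
    -- Conjugating both argument and value of a holomorphic map gives a holomorphic map, so both
    -- sides depend holomorphically on x.
    have e3 : DifferentiableAt ℂ (fun x => star (X.coords (H (star (q x))))) x := by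
      have := e2.star_star
      rw [star_star] at this
      exact DifferentiableAt.comp (g := star ∘ (fun v => X.coords (H v)) ∘ star) x this h2
    have e4 : ∀ j, DifferentiableAt ℂ (fun x => star ((X.coords (H (star (q x)))).1 j)) x :=
      differentiableAt_pi.1 e3.fst
    have e5 : ∀ j, DifferentiableAt ℂ (fun x => (X.coords (H (p x))).1 j) x :=
      differentiableAt_pi.1 e1.fst
    refine DifferentiableAt.sub ?_ e3.snd
    simp only [Hyperquadric.polar_apply, dotProduct, Matrix.mulVec]
    refine e1.snd.sub (DifferentiableAt.const_mul (DifferentiableAt.fun_sum fun j _ => ?_) _)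
    exact (e4 j).mul (DifferentiableAt.fun_sum fun k _ => (e5 k).const_mul _)
  have h0 : ∀ᶠ x in 𝓝 0, swapConj n x = x → X.polar (H (star (q x))) (H (p x)) -
      star (X.coords (H (star (q x)))).2 = 0 := by
    have hz : Filter.Tendsto (fun x : ((Fin n → ℂ) × (Fin n → ℂ)) × ℂ => x.1.1) (𝓝 0) (𝓝 0) :=
      continuous_fst.fst.tendsto _
    filter_upwards [hpt.eventually hM, hz.eventually hreal] with x h1 h2 hx
    obtain ⟨⟨z, ξ⟩, s⟩ := x
    simp only [swapConj_apply, Prod.mk.injEq] at hx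
    obtain ⟨⟨-, rfl⟩, hs⟩ := hx
    simp only at h2
    have hs' : s.im = 0 := Complex.conj_eq_iff_im.1 hs
    have hc : star (φ (z, star z)) = φ (z, star z) := Complex.conj_eq_iff_im.2 h2
    -- At a real point both arguments of the polarized equation are the point (z, s + iφ(z, z̄)) of
    -- M.
    have hpq : star (q ((z, star z), s)) = p ((z, star z), s) := by
      simp only [p, q, Prod.ext_iff, Prod.fst_star, Prod.snd_star, star_star, star_sub, star_mul',
        hs, hc, true_and]
      rw [Complex.star_def, Complex.conj_I]
      ring
    rw [hpq, Hyperquadric.polar_self, h1, Complex.ofReal_zero, mul_zero]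
    apply Complex.ext <;> simp [p, hs', h2]
  refine (eventually_eq_zero_of_vanish_on_real_points (swapConj n) (fun x => ?_) (fun x => ?_)
    hG h0).mono fun x hx => sub_eq_zero.1 hx
  · simp [swapConj_apply]
  · simp only [swapConj_apply, Prod.norm_def, norm_star]
    rw [max_comm ‖x.1.2‖]

/-- Linear forms, parametrized by `ξ`, that are constant along the images of the complexified
Segre sets and do not annihilate the transversal direction. -/
theorem exists_linear_form (hH : AnalyticAt ℂ H (0, 0)) (hφ : AnalyticAt ℂ φ (0, 0))
    (hφ0 : φ (0, 0) = 0) (hreal : ∀ᶠ z in 𝓝 (0 : Fin n → ℂ), (φ (z, star z)).im = 0)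
    (hM : ∀ᶠ p in 𝓝 ((0, 0) : (Fin n → ℂ) × ℂ),
      (p.2.im : ℂ) = φ (p.1, star p.1) → X.definingFunction (H p) = 0)
    (htrans : ((fderiv ℂ H (0, 0) : (Fin n → ℂ) × ℂ →ₗ[ℂ] (Fin d → ℂ) × ℂ).range).restrictScalars
      ℝ ⊔ X.tangentSpace (H (0, 0)) = ⊤) :
    ∃ l : (Fin n → ℂ) → ((Fin d → ℂ) × ℂ →ₗ[ℂ] ℂ),
      (∀ᶠ ξ in 𝓝 0, l ξ (fderiv ℂ H (0, 0) (0, 1)) ≠ 0) ∧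
      ∀ᶠ ξ in 𝓝 0, ∃ C, ∀ᶠ z in 𝓝 0,
        l ξ (H (z, 2 * Complex.I * (φ (z, ξ) - φ (0, ξ)))) = C := by
  set u : (Fin n → ℂ) → (Fin n → ℂ) × ℂ := fun ξ => star (ξ, -(2 * Complex.I * φ (0, ξ)))
  have hu0 : u 0 = (0, 0) := by simp [u, hφ0, Prod.ext_iff]
  have hφc : ContinuousAt (fun ξ => φ (0, ξ)) (0 : Fin n → ℂ) :=
    ContinuousAt.comp (f := fun ξ : Fin n → ℂ => ((0 : Fin n → ℂ), ξ)) hφ.continuousAt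
      (by fun_prop)
  have hu : ContinuousAt u 0 := by
    have : ContinuousAt (fun ξ : Fin n → ℂ => (ξ, -(2 * Complex.I * φ (0, ξ)))) 0 :=
      continuousAt_id.prodMk (continuousAt_const.mul hφc).neg
    exact this.star
  have hconst : ∀ᶠ ξ in 𝓝 (0 : Fin n → ℂ), ∃ C, ∀ᶠ z in 𝓝 0,
      X.polar (H (u ξ)) (H (z, 2 * Complex.I * (φ (z, ξ) - φ (0, ξ)))) = C := by
    -- The free parameter is set to s = −2iφ(0,ξ) + iφ(z,ξ): then s − iφ(z,ξ) no longer depends on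
    -- z, which fixes the linear form, while s + iφ(z,ξ) = 2i(φ(z,ξ) − φ(0,ξ)).
    have ht : Filter.Tendsto (fun y : (Fin n → ℂ) × (Fin n → ℂ) => (((y.2, y.1),
        -(2 * Complex.I * φ (0, y.1)) + Complex.I * φ (y.2, y.1)) :
          ((Fin n → ℂ) × (Fin n → ℂ)) × ℂ)) (𝓝 ((0 : Fin n → ℂ), (0 : Fin n → ℂ))) (𝓝 0) := by
      have h1 : ContinuousAt (fun y : (Fin n → ℂ) × (Fin n → ℂ) => φ (0, y.1)) (0, 0) :=
        ContinuousAt.comp (f := fun y : (Fin n → ℂ) × (Fin n → ℂ) => ((0 : Fin n → ℂ), y.1))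
          hφ.continuousAt (by fun_prop)
      have h2 : ContinuousAt (fun y : (Fin n → ℂ) × (Fin n → ℂ) => φ (y.2, y.1)) (0, 0) :=
        ContinuousAt.comp (f := fun y : (Fin n → ℂ) × (Fin n → ℂ) => (y.2, y.1))
          hφ.continuousAt (by fun_prop)
      have h3 : ContinuousAt (fun y : (Fin n → ℂ) × (Fin n → ℂ) => (((y.2, y.1),
        -(2 * Complex.I * φ (0, y.1)) + Complex.I * φ (y.2, y.1)) :
          ((Fin n → ℂ) × (Fin n → ℂ)) × ℂ)) (0, 0) :=
        (by fun_prop : ContinuousAt (fun y : (Fin n → ℂ) × (Fin n → ℂ) => (y.2, y.1))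
          (0, 0)).prodMk ((continuousAt_const.mul h1).neg.add (continuousAt_const.mul h2))
      have h4 := h3.tendsto
      simp only [hφ0, mul_zero, neg_zero, add_zero] at h4
      exact h4
    have := (ht.eventually (eventually_polar_eq hH hφ hφ0 hreal hM))
    rw [nhds_prod_eq] at this
    refine this.curry.mono fun ξ hξ => ⟨star (X.coords (H (u ξ))).2, hξ.mono fun z hz => ?_⟩
    · have e1 : -(2 * Complex.I * φ (0, ξ)) + Complex.I * φ (z, ξ) - Complex.I * φ (z, ξ) =
          -(2 * Complex.I * φ (0, ξ)) := by ring
      have e2 : -(2 * Complex.I * φ (0, ξ)) + Complex.I * φ (z, ξ) + Complex.I * φ (z, ξ) =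
          2 * Complex.I * (φ (z, ξ) - φ (0, ξ)) := by ring
      simpa only [e1, e2] using hz
  refine ⟨fun ξ => X.polar (H (u ξ)), ?_, hconst⟩
  have hcont : ContinuousAt (fun ξ => X.polar (H (u ξ)) (fderiv ℂ H (0, 0) (0, 1))) 0 := by
    have h1 : ContinuousAt (fun ξ => X.coords (H (u ξ))) 0 :=
      X.coords.continuous.continuousAt.comp (hH.continuousAt.comp_of_eq hu hu0)
    have h2 : ∀ j, ContinuousAt (fun ξ => star ((X.coords (H (u ξ))).1 j)) 0 := fun j =>
      (continuousAt_pi.1 h1.fst j).star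
    simp only [Hyperquadric.polar_apply, dotProduct]
    refine continuousAt_const.sub (continuousAt_const.mul ?_)
    exact tendsto_finsetSum _ fun j _ => (h2 j).mul continuousAt_const
  -- It suffices to treat ξ = 0. If l_0 killed H_w(0), differentiating its constancy would make it
  -- kill the whole image of dH, which would then be tangent to X. Transversality would force the
  -- differential of the defining function to vanish, yet it is nonzero on the direction (0, i).
  refine hcont.eventually_ne ?_
  intro hA
  rw [hu0] at hA
  obtain ⟨C, hC⟩ := hconst.self_of_nhds
  rw [hu0] at hC
  have hfa : AnalyticAt ℂ (fun z => φ (z, (0 : Fin n → ℂ))) 0 :=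
    AnalyticAt.comp (f := fun z : Fin n → ℂ => (z, (0 : Fin n → ℂ))) hφ
      (AnalyticAt.prod analyticAt_id analyticAt_const)
  set l0 : (Fin d → ℂ) × ℂ →L[ℂ] ℂ := LinearMap.toContinuousLinearMap (X.polar (H (0, 0)))
  have hker : ∀ v, X.polar (H (0, 0)) (fderiv ℂ H (0, 0) v) = 0 := by
    have h1 : ∀ v, X.polar (H (0, 0)) (fderiv ℂ H (0, 0) (v, 0)) = 0 := by
      intro v
      have hd : DifferentiableAt ℂ
          (fun z => H (z, 2 * Complex.I * (φ (z, 0) - φ (0, 0)))) 0 :=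
        (analyticAt_comp_graph (c := 2 * Complex.I) hfa hH).differentiableAt
      have e1 : fderiv ℂ (fun z => l0 (H (z, 2 * Complex.I * (φ (z, 0) - φ (0, 0))))) 0 = 0 := by
        have : (fun z => l0 (H (z, 2 * Complex.I * (φ (z, 0) - φ (0, 0))))) =ᶠ[𝓝 0]
            fun _ => C := hC
        rw [this.fderiv_eq, fderiv_fun_const]
        rfl
      have e2 := (l0.hasFDerivAt.comp (0 : Fin n → ℂ) hd.hasFDerivAt).fderiv
      have e3 : l0 (fderiv ℂ (fun z => H (z, 2 * Complex.I * (φ (z, 0) - φ (0, 0)))) 0 v) = 0 := by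
        have := congrArg (fun T : (Fin n → ℂ) →L[ℂ] ℂ => T v) (e2.symm.trans e1)
        exact this
      rw [(fderiv_comp_graph (c := 2 * Complex.I) hfa hH).self_of_nhds v] at e3
      simp only [sub_self, mul_zero, map_add, map_smul] at e3
      change X.polar (H (0, 0)) _ + _ • X.polar (H (0, 0)) _ = 0 at e3
      rwa [hA, smul_zero, add_zero] at e3
    rintro ⟨v, w⟩
    have : ((v, w) : (Fin n → ℂ) × ℂ) = (v, 0) + w • (0, 1) := by simp
    rw [this, map_add, map_smul, map_add, map_smul, h1, hA, smul_zero, add_zero]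
  have htop : X.tangentSpace (H (0, 0)) = ⊤ := by
    rw [sup_eq_right.2] at htrans
    · exact htrans
    · rintro _ ⟨v, rfl⟩
      change fderiv ℝ X.definingFunction (H (0, 0)) (fderiv ℂ H (0, 0) v) = 0
      rw [X.fderiv_definingFunction, hker, Complex.zero_im]
  have hmem : X.coords.symm (0, Complex.I) ∈ X.tangentSpace (H (0, 0)) := htop ▸ Submodule.mem_top
  have hzero : fderiv ℝ X.definingFunction (H (0, 0)) (X.coords.symm (0, Complex.I)) = 0 := hmem
  rw [X.fderiv_definingFunction, X.polar_apply] at hzero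
  simp at hzero

end Polarization
end Rigid

namespace Rigid

/-! ### Cramer's rule with weights. -/

section LinearAlgebra

variable {E : Type*} [AddCommGroup E] [Module ℂ E] [FiniteDimensional ℂ E]

/-- A linearly independent part of a family indexed by a set of the right size extends to a basis
with the same index set. -/
theorem exists_basis_extending {κ : Type*} [Fintype κ]
    (hcard : Fintype.card κ = Module.finrank ℂ E) (p : κ → Prop) (v : κ → E)
    (hv : LinearIndependent ℂ fun i : {i // p i} => v i) :
    ∃ b : Module.Basis κ ℂ E, ∀ i, p i → b i = v i := by
  classical
  let b0 := Module.Basis.sumExtend hv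
  have : Finite ({i // p i} ⊕ Module.Basis.sumExtendIndex hv) := Module.Finite.finite_basis b0
  have : Fintype (Module.Basis.sumExtendIndex hv) :=
    @Fintype.ofFinite _ (Finite.sum_right {i // p i})
  have h1 : Fintype.card {i // p i} + Fintype.card (Module.Basis.sumExtendIndex hv) =
      Module.finrank ℂ E := by
    rw [← Fintype.card_sum, Module.finrank_eq_card_basis b0]
  have h2 : Fintype.card {i // p i} + Fintype.card {i // ¬p i} = Module.finrank ℂ E := by
    rw [← Fintype.card_sum, ← hcard, Fintype.card_congr (Equiv.sumCompl p)]
  let e : Module.Basis.sumExtendIndex hv ≃ {i // ¬p i} := Fintype.equivOfCardEq (by omega)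
  let f : ({i // p i} ⊕ Module.Basis.sumExtendIndex hv) ≃ κ :=
    (Equiv.sumCongr (Equiv.refl _) e).trans (Equiv.sumCompl p)
  refine ⟨b0.reindex f, fun i hi => ?_⟩
  have hf : f.symm i = Sum.inl ⟨i, hi⟩ := by
    rw [Equiv.symm_apply_eq]
    simp [f]
  rw [Module.Basis.reindex_apply, hf]
  simp only [b0, Module.Basis.sumExtend, Module.Basis.reindex_apply, Module.Basis.coe_extend]
  rfl

variable {n m : ℕ} {Ξ : Type*}

/-- Cramer's rule with weights: among `n + m + 2` vectors in a space of dimension `n + m + 1`,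
of which `n + 1` are constant and independent and the others are polynomials in jets, there is a
nontrivial relation with polynomial coefficients, expressing a vector of the highest order. -/
theorem exists_weighted_relation [Nonempty Ξ] (hE : Module.finrank ℂ E = n + m + 1)
    (a : Ξ → (Fin n → ℕ) → ℂ) {base : Option (Fin n) → E} (hbase : LinearIndependent ℂ base)
    (α : Fin (m + 1) → Fin n → ℕ) (B : Fin (m + 1) → Ξ → E)
    (hB : ∀ s (μ : E →ₗ[ℂ] ℂ) (K : ℕ), order (α s) ≤ K → ∃ q : JetPoly n K,
      q.wt ≤ 2 * order (α s) - 2 ∧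
        ∀ ξ, μ (B s ξ) = MvPolynomial.eval (fun β : LowerIndex n K => a ξ β.1) q) :
    ∃ (j : Fin (m + 1)) (k : ℕ) (P : JetPoly n k) (y : Option (Fin n) → JetPoly n k)
      (x : Fin (m + 1) → JetPoly n k),
      order (α j) = k ∧ x j = 0 ∧ (∀ s, k < order (α s) → x s = 0) ∧
      (∃ ξ, MvPolynomial.eval (fun β : LowerIndex n k => a ξ β.1) P ≠ 0) ∧
      (∀ ξ, MvPolynomial.eval (fun β : LowerIndex n k => a ξ β.1) P • B j ξ =
        ∑ o, MvPolynomial.eval (fun β : LowerIndex n k => a ξ β.1) (y o) • base o +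
        ∑ s, MvPolynomial.eval (fun β : LowerIndex n k => a ξ β.1) (x s) • B s ξ) ∧
      P.wt ≤ (2 * k - 2) * (Finset.card {i | order (α i) ≤ k} - 1) ∧
      (∀ s, (x s).wt ≤ (2 * k - 2) * (Finset.card {i | order (α i) ≤ k} - 1)) ∧
      ∀ o, (y o).wt ≤ (2 * k - 2) * Finset.card {i | order (α i) ≤ k} := by
  classical
  -- Dependence is required at every ξ, so its failure for a smaller set gives one parameter ξ₁ with
  -- honest independence. A minimal S and an index j of highest order in S are used: then all B_s
  -- with s ∈ S involve only jets of order below k.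
  let Dep : Finset (Fin (m + 1)) → Prop := fun S =>
    ∀ ξ, ¬ LinearIndependent ℂ (Sum.elim base fun s : S => B s ξ)
  have huniv : Dep Finset.univ := by
    intro ξ hli
    have := hli.fintype_card_le_finrank
    simp [hE] at this
    omega
  obtain ⟨S, hS⟩ := exists_minimal_of_wellFoundedLT Dep ⟨_, huniv⟩
  have hne : S.Nonempty := by
    rw [Finset.nonempty_iff_ne_empty]
    rintro rfl
    refine hS.prop (Classical.arbitrary Ξ) ?_
    refine hbase.sum_type linearIndependent_empty_type ?_
    rw [Set.range_eq_empty (fun s : (∅ : Finset (Fin (m + 1))) => B s _), Submodule.span_empty]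
    exact disjoint_bot_right
  obtain ⟨j, hjS, hjmax⟩ := S.exists_max_image (fun s => order (α s)) hne
  obtain ⟨k, hk⟩ : ∃ k, order (α j) = k := ⟨_, rfl⟩
  simp only [hk] at hjmax
  have hnd : ¬ Dep (S.erase j) := fun h =>
    absurd (hS.le_of_le h (Finset.erase_subset j S) hjS) (Finset.notMem_erase j S)
  simp only [Dep, not_forall, not_not] at hnd
  obtain ⟨ξ₁, hξ₁⟩ := hnd
  have hcard : Fintype.card (Option (Fin n) ⊕ {s : Fin (m + 1) // s ≠ j}) = Module.finrank ℂ E := by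
    simp only [Fintype.card_sum, Fintype.card_option, Fintype.card_fin, hE,
      Fintype.card_subtype_compl, Fintype.card_unique]
    omega
  obtain ⟨b, hb⟩ : ∃ b : Module.Basis (Option (Fin n) ⊕ {s : Fin (m + 1) // s ≠ j}) ℂ E, (∀ o, b (Sum.inl o) = base o) ∧
      ∀ s : {s // s ≠ j}, s.1 ∈ S → b (Sum.inr s) = B s ξ₁ := by
    let p : (Option (Fin n) ⊕ {s : Fin (m + 1) // s ≠ j}) → Prop := Sum.elim (fun _ => True) (fun s => s.1 ∈ S)
    let f : {t // p t} → Option (Fin n) ⊕ S.erase j := fun t => match t with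
      | ⟨Sum.inl o, _⟩ => Sum.inl o
      | ⟨Sum.inr s, h⟩ => Sum.inr ⟨s.1, Finset.mem_erase.2 ⟨s.2, h⟩⟩
    have hf : Function.Injective f := by
      rintro ⟨o | s, h⟩ ⟨o' | s', h'⟩ hff
      · simpa [f] using hff
      · simp [f] at hff
      · simp [f] at hff
      · simpa [f, Subtype.ext_iff] using hff
    obtain ⟨b, hb⟩ := exists_basis_extending hcard p (Sum.elim base fun s => B s ξ₁) (by
      have := hξ₁.comp f hf
      convert! this using 1
      funext t
      rcases t with ⟨o | s, h⟩ <;> rfl)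
    exact ⟨b, fun o => hb _ trivial, fun s hs => hb (Sum.inr s) hs⟩
  have hq : ∀ s ∈ S, ∀ i : (Option (Fin n) ⊕ {s : Fin (m + 1) // s ≠ j}), ∃ q : JetPoly n k, q.wt ≤ 2 * k - 2 ∧
      ∀ ξ, b.coord i (B s ξ) = MvPolynomial.eval (fun β : LowerIndex n k => a ξ β.1) q := by
    intro s hs i
    obtain ⟨q, hq1, hq2⟩ := hB s (b.coord i) k (hjmax s hs)
    have := hjmax s hs
    exact ⟨q, hq1.trans (by omega), hq2⟩
  choose! q hqwt hqe using hq
  -- Slots outside S are filled with constant basis vectors. This makes the system square at no cost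
  -- in weight: only the |S| − 1 columns from S without j have weight 2k − 2.
  let vec : Ξ → (Option (Fin n) ⊕ {s : Fin (m + 1) // s ≠ j}) → E := fun ξ => Sum.elim base
    (fun s => if s.1 ∈ S then B s.1 ξ else b (Sum.inr s))
  let A : Matrix (Option (Fin n) ⊕ {s : Fin (m + 1) // s ≠ j}) (Option (Fin n) ⊕ {s : Fin (m + 1) // s ≠ j}) (JetPoly n k) := fun i => Sum.elim (fun o => MvPolynomial.C (b.coord i (base o)))
    (fun s => if s.1 ∈ S then q s.1 i else MvPolynomial.C (b.coord i (b (Sum.inr s))))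
  let δ : (Option (Fin n) ⊕ {s : Fin (m + 1) // s ≠ j}) → ℕ := Sum.elim (fun _ => 0) (fun s => if s.1 ∈ S then 2 * k - 2 else 0)
  let ev : Ξ → JetPoly n k →+* ℂ := fun ξ => MvPolynomial.eval (fun β : LowerIndex n k => a ξ β.1)
  have hAe : ∀ ξ i t, ev ξ (A i t) = b.coord i (vec ξ t) := by
    rintro ξ i (o | s)
    · simp [A, ev, vec]
    · by_cases hs : s.1 ∈ S
      · simpa only [A, ev, vec, Sum.elim_inr, hs, if_true] using (hqe s.1 hs i ξ).symm
      · simp [A, ev, vec, hs]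
  have hAw : ∀ i t, (A i t).wt ≤ δ t := by
    rintro i (o | s)
    · exact JetPoly.wt_C_le _
    · by_cases hs : s.1 ∈ S
      · simpa only [A, δ, Sum.elim_inr, hs, if_true] using hqwt s.1 hs i
      · simpa only [A, δ, Sum.elim_inr, hs, if_false] using JetPoly.wt_C_le _
  let r : (Option (Fin n) ⊕ {s : Fin (m + 1) // s ≠ j}) → JetPoly n k := fun i => q j i
  have hcr := Matrix.mulVec_cramer A r
  have hδ : ∑ t, δ t = (2 * k - 2) * (S.card - 1) := by
    simp only [δ, Fintype.sum_sum_type, Sum.elim_inl, Sum.elim_inr, Finset.sum_const_zero, zero_add]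
    have h1 := Fintype.sum_subtype_add_sum_subtype (fun s : Fin (m + 1) => s ≠ j)
      (fun s => if s ∈ S.erase j then 2 * k - 2 else 0)
    have h2 : ∑ s : {s // ¬ s ≠ j}, (if s.1 ∈ S.erase j then 2 * k - 2 else 0) = 0 := by
      refine Finset.sum_eq_zero fun s _ => ?_
      rw [not_not.1 s.2]
      simp
    rw [h2, add_zero, Finset.sum_ite_mem, Finset.univ_inter, Finset.sum_const, smul_eq_mul,
      Finset.card_erase_of_mem hjS, mul_comm (S.card - 1)] at h1
    rw [← h1]
    refine Finset.sum_congr rfl fun s _ => ?_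
    simp [s.2]
  have hl : S.card ≤ Finset.card {i | order (α i) ≤ k} :=
    Finset.card_le_card fun s hs => by simpa using hjmax s hs
  have hSpos : 1 ≤ S.card := hne.card_pos
  have hδl : ∑ t, δ t ≤ (2 * k - 2) * (Finset.card {i | order (α i) ≤ k} - 1) := by
    rw [hδ]
    exact Nat.mul_le_mul_left _ (by omega)
  have hcw : ∀ t, (A.cramer r t).wt ≤ ∑ t', Function.update δ t (2 * k - 2) t' := by
    intro t
    rw [Matrix.cramer_apply]
    refine JetPoly.wt_det_le _ _ fun i t' => ?_
    by_cases h : t' = t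
    · subst h
      simpa [r] using hqwt j hjS i
    · simpa [Matrix.updateCol_ne h, Function.update_of_ne h] using hAw i t'
  have hrel : ∀ ξ, ev ξ A.det • B j ξ = ∑ t, ev ξ (A.cramer r t) • vec ξ t := by
    intro ξ
    refine b.ext_elem fun i => ?_
    have h1 := congrArg (ev ξ) (congrFun hcr i)
    simp only [Matrix.mulVec, dotProduct, map_sum, map_mul, hAe, Pi.smul_apply, smul_eq_mul] at h1
    have h2 : ev ξ (r i) = b.coord i (B j ξ) := (hqe j hjS i ξ).symm
    rw [h2] at h1
    simp only [Module.Basis.coord_apply] at h1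
    simp only [map_smul, map_sum, Finsupp.smul_apply, Finsupp.finsetSum_apply, smul_eq_mul, ← h1]
    exact Finset.sum_congr rfl fun t _ => mul_comm _ _
  -- The basis b was chosen to agree with all the columns at ξ₁, so the matrix there is the identity
  -- and the leading coefficient is not identically zero.
  have hdet1 : ev ξ₁ A.det = 1 := by
    rw [RingHom.map_det]
    have : (ev ξ₁).mapMatrix A = 1 := by
      ext i t
      rw [RingHom.mapMatrix_apply, Matrix.map_apply, hAe]
      have hv : vec ξ₁ t = b t := by
        rcases t with o | s
        · exact (hb.1 o).symm
        · by_cases hs : s.1 ∈ S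
          · simpa only [vec, Sum.elim_inr, hs, if_true] using (hb.2 s hs).symm
          · simp only [vec, Sum.elim_inr, hs, if_false]
      rw [hv, Module.Basis.coord_apply, Module.Basis.repr_self, Matrix.one_apply,
        Finsupp.single_apply]
      simp only [eq_comm]
    rw [this, Matrix.det_one]
  -- Putting B_j into an auxiliary slot gives a family containing the base and all of B_S. A nonzero
  -- determinant would make these independent at ξ, contrary to `Dep S`; the auxiliary vectors thus
  -- drop out of the relation.
  have hzero : ∀ ξ (s : {s // s ≠ j}), s.1 ∉ S → ev ξ (A.cramer r (Sum.inr s)) = 0 := by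
    intro ξ s hs
    by_contra hne0
    let w : (Option (Fin n) ⊕ {s : Fin (m + 1) // s ≠ j}) → E := Function.update (vec ξ) (Sum.inr s) (B j ξ)
    have hdet : ev ξ (A.cramer r (Sum.inr s)) = b.det w := by
      rw [Matrix.cramer_apply, RingHom.map_det, Module.Basis.det_apply]
      congr 1
      ext i t
      rw [RingHom.mapMatrix_apply, Matrix.map_apply, Module.Basis.toMatrix_apply]
      by_cases h : t = Sum.inr s
      · subst h
        simpa [w, r] using (hqe j hjS i ξ).symm
      · simp only [w, Matrix.updateCol_ne h, Function.update_of_ne h]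
        exact hAe ξ i t
    rw [hdet] at hne0
    have hli : LinearIndependent ℂ w :=
      (b.is_basis_iff_det.2 (isUnit_iff_ne_zero.2 hne0)).1
    let f : Option (Fin n) ⊕ S → (Option (Fin n) ⊕ {s : Fin (m + 1) // s ≠ j}) := Sum.elim Sum.inl
      (fun s' => if h : s'.1 = j then Sum.inr s else Sum.inr ⟨s'.1, h⟩)
    have hf : Function.Injective f := by
      rintro (o | ⟨s1, h1⟩) (o' | ⟨s2, h2⟩) hff
      · simpa [f] using hff
      · by_cases e2 : s2 = j <;> simp [f, e2] at hff
      · by_cases e1 : s1 = j <;> simp [f, e1] at hff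
      · by_cases e1 : s1 = j <;> by_cases e2 : s2 = j
        · simp [e1, e2]
        · simp only [f, Sum.elim_inr, e1, e2, dif_pos, dif_neg, not_false_eq_true,
            Sum.inr.injEq] at hff
          exact absurd h2 (by rw [hff] at hs; exact hs)
        · simp only [f, Sum.elim_inr, e1, e2, dif_pos, dif_neg, not_false_eq_true,
            Sum.inr.injEq] at hff
          exact absurd h1 (by rw [← hff] at hs; exact hs)
        · simpa [f, e1, e2] using hff
    refine hS.prop ξ ?_
    convert! hli.comp f hf using 1
    funext t
    rcases t with o | ⟨s', hs'⟩
    · change vec ξ (Sum.inl o) = w (Sum.inl o)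
      rw [show w (Sum.inl o) = vec ξ (Sum.inl o) from Function.update_of_ne Sum.inl_ne_inr _ _]
    · by_cases e : s' = j
      · subst e
        simp [f, w]
      · have hss : (⟨s', e⟩ : {s // s ≠ j}) ≠ s := by
          rintro rfl
          exact hs hs'
        have hss' : (Sum.inr ⟨s', e⟩ : (Option (Fin n) ⊕ {s : Fin (m + 1) // s ≠ j})) ≠ Sum.inr s :=
          fun h => hss (Sum.inr_injective h)
        simp only [Function.comp, f, Sum.elim_inr, e, dif_neg, not_false_eq_true, w,
          Function.update_of_ne hss']
        simp [vec, hs']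
  refine ⟨j, k, A.det, fun o => A.cramer r (Sum.inl o),
    fun s => if h : s ≠ j ∧ s ∈ S then A.cramer r (Sum.inr ⟨s, h.1⟩) else 0,
    hk, by simp, fun s hs => ?_, ⟨ξ₁, ?_⟩, fun ξ => ?_, ?_, fun s => ?_, fun o => ?_⟩
  · refine dif_neg ?_
    exact fun h => absurd (hjmax s h.2) (not_le.2 hs)
  · change ev ξ₁ A.det ≠ 0
    rw [hdet1]
    exact one_ne_zero
  · change ev ξ A.det • B j ξ = ∑ o, ev ξ (A.cramer r (Sum.inl o)) • base o +
      ∑ s, ev ξ (if h : s ≠ j ∧ s ∈ S then A.cramer r (Sum.inr ⟨s, h.1⟩) else 0) • B s ξ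
    rw [hrel, Fintype.sum_sum_type]
    congr 1
    rw [← Fintype.sum_subtype_add_sum_subtype (fun s : Fin (m + 1) => s ≠ j)]
    rw [Finset.sum_eq_zero (s := (Finset.univ : Finset {s // ¬ s ≠ j})), add_zero]
    · refine Finset.sum_congr rfl fun s _ => ?_
      by_cases hs : s.1 ∈ S
      · rw [dif_pos ⟨s.2, hs⟩]
        simp [vec, hs]
      · rw [hzero ξ s hs, dif_neg (fun h => hs h.2), map_zero, zero_smul, zero_smul]
    · intro s _
      rw [dif_neg (fun h => s.2 h.1), map_zero, zero_smul]
  · exact (JetPoly.wt_det_le A δ hAw).trans hδl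
  · beta_reduce
    by_cases h : s ≠ j ∧ s ∈ S
    · rw [dif_pos h]
      refine (hcw _).trans ?_
      -- Here B_j replaces a column of the same weight bound; replacing a constant base column
      -- instead costs one more 2k − 2, hence the larger bound for y.
      have : Function.update δ (Sum.inr ⟨s, h.1⟩) (2 * k - 2) = δ := by
        rw [Function.update_eq_self_iff]
        simp [δ, h.2]
      rwa [this]
    · rw [dif_neg h]
      exact JetPoly.wt_zero_le
  · refine (hcw _).trans ?_
    rw [Finset.sum_update_of_mem (Finset.mem_univ _)]
    refine (Nat.add_le_add_left (Finset.sum_le_sum_of_subset Finset.sdiff_subset) _).trans ?_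
    have h2 : Finset.card {i | order (α i) ≤ k} = Finset.card {i | order (α i) ≤ k} - 1 + 1 := by
      omega
    rw [h2, Nat.mul_add, mul_one]
    omega

end LinearAlgebra
end Rigid

namespace Rigid

/-! ### Jets of H along the graphs, and the action of linear forms on them. -/

section JetVector

variable {n : ℕ} {E : Type*} [NormedAddCommGroup E] [NormedSpace ℂ E] [FiniteDimensional ℂ E]

/-- The derivative of order `α` at the origin of `z ↦ H (z, c (f z - f 0))`. -/
noncomputable def jetVector (c : ℂ) (H : (Fin n → ℂ) × ℂ → E) (f : (Fin n → ℂ) → ℂ)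
    (α : Fin n → ℕ) : E :=
  ∑ i, mixedDeriv α (fun z => (Module.finBasis ℂ E).coord i (H (z, c * (f z - f 0)))) 0 •
    Module.finBasis ℂ E i

/-- The part of `jetVector c H f α` that involves only derivatives of `f` of lower order. -/
noncomputable def lowerJetVector (c : ℂ) (H : (Fin n → ℂ) × ℂ → E) (f : (Fin n → ℂ) → ℂ)
    (α : Fin n → ℕ) : E :=
  jetVector c H f α - (c * mixedDeriv α f 0) • fderiv ℂ H (0, 0) (0, 1)

variable {c : ℂ} {H : (Fin n → ℂ) × ℂ → E} {f : (Fin n → ℂ) → ℂ}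

theorem analyticAt_coord_comp (hH : AnalyticAt ℂ H (0, 0)) (i : Fin (Module.finrank ℂ E)) :
    AnalyticAt ℂ (fun p => (Module.finBasis ℂ E).coord i (H p)) (0, 0) :=
  (LinearMap.toContinuousLinearMap ((Module.finBasis ℂ E).coord i)).analyticAt _ |>.comp hH

theorem apply_jetVector_eq_zero (hH : AnalyticAt ℂ H (0, 0)) (hf : AnalyticAt ℂ f 0)
    (l : E →ₗ[ℂ] ℂ) {C : ℂ} (hl : ∀ᶠ z in 𝓝 0, l (H (z, c * (f z - f 0))) = C)
    (α : Fin n → ℕ) (hα : 0 < order α) : l (jetVector c H f α) = 0 := by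
  have han := fun i => analyticAt_comp_graph (c := c) hf (analyticAt_coord_comp hH i)
  have h1 := (mixedDeriv_sum Finset.univ (fun i => l (Module.finBasis ℂ E i)) _ han
    α).self_of_nhds
  have h2 : (fun z => ∑ i, l (Module.finBasis ℂ E i) *
      (Module.finBasis ℂ E).coord i (H (z, c * (f z - f 0)))) =
      fun z => l (H (z, c * (f z - f 0))) := by
    funext z
    conv_rhs => rw [← (Module.finBasis ℂ E).sum_repr (H (z, c * (f z - f 0)))]
    simp only [map_sum, map_smul, smul_eq_mul, Module.Basis.coord_apply, mul_comm]
  have h3 : AnalyticAt ℂ (fun z => l (H (z, c * (f z - f 0)))) 0 :=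
    (analyticAt_const (v := C)).congr (hl.mono fun z hz => hz.symm)
  rw [h2, ((mixedDeriv_congr α h3 hl).trans (mixedDeriv_const α hα C)).self_of_nhds] at h1
  simp only [jetVector, map_sum, map_smul, smul_eq_mul]
  exact (Finset.sum_congr rfl fun i _ => mul_comm _ _).trans h1.symm

/-- Since l annihilates the full jet vector, its value on the lower part is forced to be a multiple
of the top derivative, with a factor that does not depend on α. -/
theorem apply_lowerJetVector (hH : AnalyticAt ℂ H (0, 0)) (hf : AnalyticAt ℂ f 0)
    (l : E →ₗ[ℂ] ℂ) {C : ℂ} (hl : ∀ᶠ z in 𝓝 0, l (H (z, c * (f z - f 0))) = C)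
    (α : Fin n → ℕ) (hα : 0 < order α) :
    l (lowerJetVector c H f α) = -(c * mixedDeriv α f 0) * l (fderiv ℂ H (0, 0) (0, 1)) := by
  rw [lowerJetVector, map_sub, apply_jetVector_eq_zero hH hf l hl α hα, map_smul, smul_eq_mul]
  ring

/-- First-order analogue, with H_{z_i}(0) in the role of the lower jet vector: the constant base
vectors produce the same common factor. -/
theorem apply_fderiv_single (hH : AnalyticAt ℂ H (0, 0)) (hf : AnalyticAt ℂ f 0)
    (l : E →ₗ[ℂ] ℂ) {C : ℂ} (hl : ∀ᶠ z in 𝓝 0, l (H (z, c * (f z - f 0))) = C) (i : Fin n) :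
    l (fderiv ℂ H (0, 0) (Pi.single i 1, 0)) =
      -(c * mixedDeriv (Pi.single i 1) f 0) * l (fderiv ℂ H (0, 0) (0, 1)) := by
  let l' : E →L[ℂ] ℂ := LinearMap.toContinuousLinearMap l
  have hd : DifferentiableAt ℂ (fun z => H (z, c * (f z - f 0))) 0 :=
    (analyticAt_comp_graph hf hH).differentiableAt
  have e1 : fderiv ℂ (fun z => l' (H (z, c * (f z - f 0)))) 0 = 0 := by
    have : (fun z => l' (H (z, c * (f z - f 0)))) =ᶠ[𝓝 0] fun _ => C := hl
    rw [this.fderiv_eq, fderiv_fun_const]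
    rfl
  have e2 := (l'.hasFDerivAt.comp (0 : Fin n → ℂ) hd.hasFDerivAt).fderiv
  have e3 : l' (fderiv ℂ (fun z => H (z, c * (f z - f 0))) 0 (Pi.single i 1)) = 0 :=
    congrArg (fun T : (Fin n → ℂ) →L[ℂ] ℂ => T (Pi.single i 1)) (e2.symm.trans e1)
  have hFE := FiniteDimensional.complete ℂ E
  rw [(fderiv_comp_graph (c := c) hf hH).self_of_nhds] at e3
  simp only [sub_self, mul_zero, map_add, map_smul, smul_eq_mul] at e3
  have e4 : mixedDeriv (Pi.single i 1) f 0 = fderiv ℂ f 0 (Pi.single i 1) :=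
    (mixedDeriv_single (Ξ := Unit) (φ := fun _ => f) (fun _ => hf) i ()).self_of_nhds
  rw [e4]
  have e5 : ∀ v, l' v = l v := fun v => rfl
  rw [e5, e5] at e3
  linear_combination e3

/-- The functional μ is arbitrary because the basis used in Cramer's rule is chosen later; K may
exceed |α| so that vectors of different orders share one polynomial ring. -/
theorem exists_jetPoly_apply_lowerJetVector {Ξ : Type*} (φ : Ξ → (Fin n → ℂ) → ℂ)
    (hφ : ∀ ξ, AnalyticAt ℂ (φ ξ) 0) (hH : AnalyticAt ℂ H (0, 0)) (α : Fin n → ℕ)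
    (hα : 0 < order α) (μ : E →ₗ[ℂ] ℂ) {K : ℕ} (hK : order α ≤ K) :
    ∃ q : JetPoly n K, q.wt ≤ 2 * order α - 2 ∧ ∀ ξ, μ (lowerJetVector c H (φ ξ) α) =
      MvPolynomial.eval (fun β : LowerIndex n K => mixedDeriv β.1 (φ ξ) 0) q := by
  have h : ∀ i, ∃ q : JetPoly n K, q.wt ≤ 2 * order α - 2 ∧ ∀ ξ,
      (Module.finBasis ℂ E).coord i (lowerJetVector c H (φ ξ) α) =
        MvPolynomial.eval (fun β : LowerIndex n K => mixedDeriv β.1 (φ ξ) 0) q := by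
    intro i
    obtain ⟨F, hF, hFe⟩ := exists_mixedDeriv_comp_eq (c := c) hφ (analyticAt_coord_comp hH i) α hα
    obtain ⟨q, hq, hqe⟩ := hF.exists_jetPoly hK
    refine ⟨q, hq, fun ξ => ?_⟩
    have e1 := (hFe ξ).self_of_nhds
    have e2 : fderiv ℂ (fun p => (Module.finBasis ℂ E).coord i (H p)) (0, 0) (0, 1) =
        (Module.finBasis ℂ E).coord i (fderiv ℂ H (0, 0) (0, 1)) := by
      have := ((LinearMap.toContinuousLinearMap ((Module.finBasis ℂ E).coord i)).hasFDerivAt.comp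
        ((0, 0) : (Fin n → ℂ) × ℂ) hH.differentiableAt.hasFDerivAt).fderiv
      exact congrArg (fun T : (Fin n → ℂ) × ℂ →L[ℂ] ℂ => T (0, 1)) this
    have e3 : (Module.finBasis ℂ E).coord i (jetVector c H (φ ξ) α) = mixedDeriv α
        (fun z => (Module.finBasis ℂ E).coord i (H (z, c * (φ ξ z - φ ξ 0)))) 0 := by
      rw [jetVector, Module.Basis.coord_apply, Module.Basis.repr_sum_self]
    simp only [sub_self, mul_zero] at e1
    rw [← hqe, lowerJetVector, map_sub, map_smul, e3, e1, e2, smul_eq_mul]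
    ring
  choose q hq hqe using h
  refine ⟨∑ i, MvPolynomial.C (μ (Module.finBasis ℂ E i)) * q i,
    JetPoly.wt_sum_le _ _ fun i _ => ?_, fun ξ => ?_⟩
  · have := JetPoly.wt_mul_le (JetPoly.wt_C_le (n := n) (k := K) (d := 0)
      (μ (Module.finBasis ℂ E i))) (hq i)
    rwa [zero_add] at this
  · conv_lhs => rw [← (Module.finBasis ℂ E).sum_repr (lowerJetVector c H (φ ξ) α)]
    simp only [map_sum, map_smul, smul_eq_mul, map_mul, MvPolynomial.eval_C, ← hqe,
      Module.Basis.coord_apply, mul_comm]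

end JetVector

theorem analyticOnNhd_eval {F : Type*} [NormedAddCommGroup F] [NormedSpace ℂ F] {U : Set F}
    {σ : Type*} {a : σ → F → ℂ} (ha : ∀ i, AnalyticOnNhd ℂ (a i) U) (q : MvPolynomial σ ℂ) :
    AnalyticOnNhd ℂ (fun ξ => MvPolynomial.eval (fun i => a i ξ) q) U := by
  induction q using MvPolynomial.induction_on with
  | C c => simpa using analyticOnNhd_const
  | add p q hp hq => exact fun ξ hξ => by simpa using (hp ξ hξ).fun_add (hq ξ hξ)
  | mul_X p i hp => exact fun ξ hξ => by simpa using (hp ξ hξ).fun_mul (ha i ξ hξ)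

/-- The images of the coordinate directions under an injective linear map are independent. -/
theorem linearIndependent_images {n : ℕ} {E : Type*} [AddCommGroup E] [Module ℂ E]
    (T : (Fin n → ℂ) × ℂ →ₗ[ℂ] E) (hT : Function.Injective T) :
    LinearIndependent ℂ (fun o : Option (Fin n) =>
      T (o.elim (0, 1) fun i => (Pi.single i 1, 0))) := by
  refine LinearIndependent.map' (v := fun o : Option (Fin n) =>
    (o.elim (0, 1) fun i => (Pi.single i 1, 0) : (Fin n → ℂ) × ℂ)) ?_ T (LinearMap.ker_eq_bot.2 hT)
  rw [Fintype.linearIndependent_iff]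
  intro g hg o
  rw [Fintype.sum_option] at hg
  have h1 := congrArg Prod.fst hg
  have h2 := congrArg Prod.snd hg
  simp only [Option.elim, Prod.fst_add, Prod.snd_add, Prod.smul_fst, Prod.smul_snd, Prod.fst_sum,
    Prod.snd_sum, smul_zero, Finset.sum_const_zero, zero_add, smul_eq_mul, mul_one, mul_zero, add_zero,
    Prod.fst_zero, Prod.snd_zero] at h1 h2
  rcases o with _ | i
  · exact h2
  · have := congrFun h1 i
    simpa [Finset.sum_apply, Pi.single_apply] using this

end Rigid

/-! ### From the vector relation to the relation among derivatives. -/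

theorem corollary2p3 (n m : ℕ)
    -- `φ(z, χ)` is holomorphic on an open set `D` containing the origin
    (D : Set ((Fin n → ℂ) × (Fin n → ℂ))) (hD : IsOpen D) (h0D : (0, 0) ∈ D)
    (hDconn : IsPreconnected {χ : Fin n → ℂ | ((0 : Fin n → ℂ), star χ) ∈ D})
    (φ : (Fin n → ℂ) × (Fin n → ℂ) → ℂ) (hφ : AnalyticOnNhd ℂ φ D)
    -- `φ(z, z̄)` is real-valued
    (hφreal : ∀ z : Fin n → ℂ, (z, star z) ∈ D → (φ (z, star z)).im = 0)
    -- `M` passes through `0` and is given near `0` by `Im w = φ(z, z̄)`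
    (M : Set ((Fin n → ℂ) × ℂ)) (h0M : (0, 0) ∈ M)
    (hM : ∀ᶠ p in 𝓝 ((0, 0) : (Fin n → ℂ) × ℂ), p ∈ M ↔ (p.2.im : ℂ) = φ (p.1, star p.1))
    (hemb : ∃ X : Rigid.Hyperquadric (n + m), Rigid.TransversallyEmbeddable M X)
    (α : Fin (m + 1) → (Fin n → ℕ)) (hα : ∀ j, 2 ≤ Rigid.order (α j)) :
    ∃ k : ℕ, (∃ j, Rigid.order (α j) = k) ∧
      ∃ (P : Fin (m + 1) → Rigid.JetPoly n k) (R : Rigid.JetPoly n k),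
        (∀ χ : Fin n → ℂ, ((0 : Fin n → ℂ), star χ) ∈ D →
          ∑ j with Rigid.order (α j) = k, (P j).evalAt φ χ * Rigid.derivAtZero φ (α j) χ =
            R.evalAt φ χ) ∧
        (∃ j, Rigid.order (α j) = k ∧
          ∃ χ : Fin n → ℂ, ((0 : Fin n → ℂ), star χ) ∈ D ∧ (P j).evalAt φ χ ≠ 0) ∧
        (∀ j, Rigid.order (α j) = k →
          (P j).wt ≤ (2 * k - 2) * (Finset.card {i | Rigid.order (α i) ≤ k} - 1)) ∧
        R.wt ≤ (2 * k - 2) * Finset.card {i | Rigid.order (α i) ≤ k} + 1 := by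
  classical
  obtain ⟨X, Ω, H, hΩ, hMΩ, hH, hinj, -, hmaps, htrans⟩ := hemb
  have hH0 : AnalyticAt ℂ H (0, 0) := hH _ (hMΩ h0M)
  have hφ0 : φ (0, 0) = 0 := by
    have := (hM.self_of_nhds.1 h0M).symm
    simpa using this
  have hreal : ∀ᶠ z in 𝓝 (0 : Fin n → ℂ), (φ (z, star z)).im = 0 := by
    have hc : Filter.Tendsto (fun z : Fin n → ℂ => (z, star z)) (𝓝 0) (𝓝 (0, 0)) := by
      have : Continuous (fun z : Fin n → ℂ => (z, star z)) := by fun_prop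
      simpa using this.tendsto 0
    exact (hc.eventually (hD.mem_nhds h0D)).mono fun z hz => hφreal z hz
  have hM' : ∀ᶠ p in 𝓝 ((0, 0) : (Fin n → ℂ) × ℂ),
      (p.2.im : ℂ) = φ (p.1, star p.1) → X.definingFunction (H p) = 0 :=
    hM.mono fun p hp h => hmaps (hp.2 h)
  obtain ⟨l, hlA, hlC⟩ := Rigid.exists_linear_form hH0 (hφ _ h0D) hφ0 hreal hM' (htrans _ h0M)
  set A := fderiv ℂ H (0, 0) (0, 1)
  set c : ℂ := 2 * Complex.I
  have hc0 : c ≠ 0 := by simp [c]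
  let U : Set (Fin n → ℂ) := {ξ | ((0 : Fin n → ℂ), ξ) ∈ D}
  have hU0 : (0 : Fin n → ℂ) ∈ U := h0D
  have hUopen : IsOpen U := hD.preimage (by fun_prop)
  have hUconn : IsPreconnected U := by
    have : U = star '' {χ : Fin n → ℂ | ((0 : Fin n → ℂ), star χ) ∈ D} := by
      ext ξ
      constructor
      · exact fun h => ⟨star ξ, by simpa [U] using h, star_star ξ⟩
      · rintro ⟨χ, h, rfl⟩
        exact h
    rw [this]
    exact hDconn.image _ continuous_star.continuousOn
  let a : (Fin n → ℂ) → (Fin n → ℕ) → ℂ := fun ξ β => Rigid.mixedDeriv β (fun z => φ (z, ξ)) 0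
  have ha : ∀ β, AnalyticOnNhd ℂ (fun ξ => a ξ β) U := fun β ξ hξ =>
    AnalyticAt.comp (f := fun ξ : Fin n → ℂ => ((0 : Fin n → ℂ), ξ))
      (Rigid.analyticOnNhd_mixedDeriv_fst hD hφ β (0, ξ) hξ)
      (AnalyticAt.prod analyticAt_const analyticAt_id)
  have hslice : ∀ ξ ∈ U, AnalyticAt ℂ (fun z => φ (z, ξ)) 0 := fun ξ hξ =>
    AnalyticAt.comp (f := fun z : Fin n → ℂ => (z, ξ)) (hφ (0, ξ) hξ)
      (AnalyticAt.prod analyticAt_id analyticAt_const)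
  have : Nonempty U := ⟨⟨0, hU0⟩⟩
  obtain ⟨j, k, P, y, x, hjk, hxj, hxk, ⟨ξ₁, hξ₁⟩, hrel, hPwt, hxwt, hywt⟩ :=
    Rigid.exists_weighted_relation (n := n) (m := m) (Ξ := U)
      (E := (Fin (n + m) → ℂ) × ℂ) (by simp) (fun ξ => a ξ.1)
      (Rigid.linearIndependent_images (fderiv ℂ H (0, 0)).toLinearMap (hinj _ (hMΩ h0M))) α
      (fun s ξ => Rigid.lowerJetVector c H (fun z => φ (z, ξ.1)) (α s))
      (fun s μ K hK => Rigid.exists_jetPoly_apply_lowerJetVector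
        (fun (ξ : U) z => φ (z, ξ.1)) (fun ξ => hslice ξ.1 ξ.2) hH0 (α s)
        (by have := hα s; omega) μ hK)
  have hk2 : 2 ≤ k := hjk ▸ hα j
  let ev : (Fin n → ℂ) → Rigid.JetPoly n k →+* ℂ := fun ξ =>
    MvPolynomial.eval (fun β : Rigid.LowerIndex n k => a ξ β.1)
  -- Order-k terms of the relation are moved to the left. In R below, base vectors contribute
  -- φ_{z_i} (a variable since k ≥ 2) and −1/c, and the B_s of order below k contribute their own
  -- variable.
  let Q : Fin (m + 1) → Rigid.JetPoly n k := fun s => if s = j then P else -x s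
  let e : Fin n → Rigid.LowerIndex n k := fun i =>
    ⟨Pi.single i 1, by rw [Rigid.order_single]; omega⟩
  let R : Rigid.JetPoly n k := ∑ i, y (some i) * MvPolynomial.X (e i) +
    MvPolynomial.C (-c⁻¹) * y none +
    ∑ s, if h : Rigid.order (α s) < k then
      x s * MvPolynomial.X ⟨α s, by have := hα s; omega, h⟩ else 0
  have hloc : ∀ᶠ ξ in 𝓝 (0 : Fin n → ℂ),
      ∑ s with Rigid.order (α s) = k, ev ξ (Q s) * a ξ (α s) = ev ξ R := by
    filter_upwards [hlA, hlC, hUopen.mem_nhds hU0] with ξ hA hC hξ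
    obtain ⟨C, hC⟩ := hC
    have h1 := congrArg (l ξ) (hrel ⟨ξ, hξ⟩)
    have hl1 := fun s => Rigid.apply_lowerJetVector (c := c) hH0 (hslice ξ hξ) (l ξ) hC (α s)
      (by have := hα s; omega)
    have hl2 := Rigid.apply_fderiv_single (c := c) hH0 (hslice ξ hξ) (l ξ) hC
    change l ξ (ev ξ P • _) = l ξ (∑ o, ev ξ (y o) • _ + ∑ s, ev ξ (x s) • _) at h1
    simp only [map_add, map_sum, map_smul, smul_eq_mul, hl1, Fintype.sum_option] at h1
    change _ = ev ξ (y none) * l ξ A +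
      ∑ i, ev ξ (y (some i)) * l ξ (fderiv ℂ H (0, 0) (Pi.single i 1, 0)) + _ at h1
    simp only [hl2] at h1
    change ev ξ P * (-(c * a ξ (α j)) * l ξ A) = ev ξ (y none) * l ξ A +
      ∑ i, ev ξ (y (some i)) * (-(c * a ξ (Pi.single i 1)) * l ξ A) +
      ∑ s, ev ξ (x s) * (-(c * a ξ (α s)) * l ξ A) at h1
    -- Division by the common factor −c l_ξ(H_w(0)), nonzero near ξ = 0, removes the linear form.
    have h2 : ev ξ P * a ξ (α j) = ∑ i, ev ξ (y (some i)) * a ξ (Pi.single i 1) +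
        -c⁻¹ * ev ξ (y none) + ∑ s, ev ξ (x s) * a ξ (α s) := by
      have hcA : -c * l ξ A ≠ 0 := mul_ne_zero (neg_ne_zero.2 hc0) hA
      apply mul_left_cancel₀ hcA
      rw [mul_add, mul_add, Finset.mul_sum, Finset.mul_sum]
      have t1 : -c * l ξ A * (-c⁻¹ * ev ξ (y none)) = ev ξ (y none) * l ξ A := by
        field_simp
      rw [t1]
      calc _ = ev ξ P * (-(c * a ξ (α j)) * l ξ A) := by ring
        _ = _ := h1
        _ = _ := by
          rw [add_comm (ev ξ (y none) * l ξ A)]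
          congr 1
          · congr 1
            exact Finset.sum_congr rfl fun i _ => by ring
          · exact Finset.sum_congr rfl fun i _ => by ring
    have h3 : ev ξ R = ∑ i, ev ξ (y (some i)) * a ξ (Pi.single i 1) +
        -c⁻¹ * ev ξ (y none) + ∑ s with Rigid.order (α s) < k, ev ξ (x s) * a ξ (α s) := by
      simp only [R, map_add, map_sum, map_mul]
      rw [Finset.sum_filter]
      congr 1
      · congr 1
        · exact Finset.sum_congr rfl fun i _ => by simp [ev, e]
        · simp [ev]
      · refine Finset.sum_congr rfl fun s _ => ?_
        by_cases h : Rigid.order (α s) < k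
        · rw [dif_pos h, if_pos h]
          simp [ev]
        · rw [dif_neg h, if_neg h, map_zero]
    have h4 : ∑ s with Rigid.order (α s) = k, ev ξ (Q s) * a ξ (α s) =
        ev ξ P * a ξ (α j) - ∑ s with Rigid.order (α s) = k, ev ξ (x s) * a ξ (α s) := by
      have hjm : j ∈ Finset.univ.filter fun s => Rigid.order (α s) = k := by simp [hjk]
      rw [← Finset.add_sum_erase _ _ hjm, ← Finset.add_sum_erase _ (fun s => ev ξ (x s) * _) hjm,
        hxj, map_zero, zero_mul, zero_add, sub_eq_add_neg, ← Finset.sum_neg_distrib]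
      congr 1
      · simp [Q]
      · refine Finset.sum_congr rfl fun s hs => ?_
        simp [Q, Finset.ne_of_mem_erase hs]
    have h5 : ∑ s, ev ξ (x s) * a ξ (α s) =
        ∑ s with Rigid.order (α s) < k, ev ξ (x s) * a ξ (α s) +
        ∑ s with Rigid.order (α s) = k, ev ξ (x s) * a ξ (α s) := by
      rw [Finset.sum_filter, Finset.sum_filter, ← Finset.sum_add_distrib]
      refine Finset.sum_congr rfl fun s _ => ?_
      rcases lt_trichotomy (Rigid.order (α s)) k with h | h | h
      · simp [h, h.ne]
      · simp [h]
      · simp [h.not_gt, h.ne', hxk s h]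
    rw [h4, h3, h2, h5]
    ring
  -- The forms l_ξ exist only near 0, but both sides of the resulting identity are analytic on all
  -- of the connected set `U`.
  have hglob : Set.EqOn (fun ξ => ∑ s with Rigid.order (α s) = k, ev ξ (Q s) * a ξ (α s))
      (fun ξ => ev ξ R) U :=
    AnalyticOnNhd.eqOn_of_preconnected_of_eventuallyEq
      (Finset.analyticOnNhd_fun_sum _ fun s _ =>
        (Rigid.analyticOnNhd_eval (fun β : Rigid.LowerIndex n k => ha β.1) (Q s)).mul (ha (α s)))
      (Rigid.analyticOnNhd_eval (fun β : Rigid.LowerIndex n k => ha β.1) R) hUconn hU0 hloc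
  refine ⟨k, ⟨j, hjk⟩, Q, R, fun χ hχ => hglob (x := star χ) hχ, ⟨j, hjk, star ξ₁.1, ?_, ?_⟩,
    fun s _ => ?_, ?_⟩
  · rw [star_star]
    exact ξ₁.2
  · change ev (star (star ξ₁.1)) (Q j) ≠ 0
    rw [star_star]
    simpa [Q] using hξ₁
  · by_cases h : s = j
    · simpa [Q, h] using hPwt
    · simpa [Q, h] using Rigid.JetPoly.wt_neg_le (hxwt s)
  · refine Rigid.JetPoly.wt_add_le (Rigid.JetPoly.wt_add_le
      (Rigid.JetPoly.wt_sum_le _ _ fun i _ => ?_) ?_) (Rigid.JetPoly.wt_sum_le _ _ fun s _ => ?_)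
    · have h1 := Rigid.JetPoly.wt_mul_le (hywt (some i)) (Rigid.JetPoly.wt_X_le (e i))
      have h2 : Rigid.varWeight (e i) = 1 := by simp [Rigid.varWeight, e, Rigid.order_single]
      rwa [h2] at h1
    · have h1 := Rigid.JetPoly.wt_mul_le (Rigid.JetPoly.wt_C_le (d := 0) (-c⁻¹)) (hywt none)
      omega
    · by_cases h : Rigid.order (α s) < k
      · rw [dif_pos h]
        have h1 := Rigid.JetPoly.wt_mul_le (hxwt s)
          (Rigid.JetPoly.wt_X_le ⟨α s, by have := hα s; omega, h⟩)
        refine h1.trans ?_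
        -- With l ≥ 1 the subtraction l − 1 is exact, and the variable of order below k adds at most
        -- 2k − 3, less than the remaining 2k − 2.
        have h2 : 1 ≤ Finset.card {i | Rigid.order (α i) ≤ k} :=
          Finset.card_pos.2 ⟨j, by simp [hjk]⟩
        obtain ⟨t, ht⟩ := Nat.exists_eq_add_of_le' h2
        rw [ht, Nat.add_sub_cancel, Nat.mul_add, mul_one]
        simp only [Rigid.varWeight]
        omega
      · rw [dif_neg h]
        exact Rigid.JetPoly.wt_zero_le
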